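/- Work over $\mathbb C$. Let $m,n\ge 0$ and let $\mathfrak g=\mathfrak{osp}(2m|2n)$, with weights $\pm\delta_i$ $(1\le i\le n)$ and $\pm\varepsilon_j$ $(1\le j\le m)$ of the natural module $\mathbb C^{2n|2m}$ with respect to the standard Cartan subalgebra $\mathfrak h$. Borel subalgebras are those containing $\mathfrak h$, i.e. those given by positive systems of roots. Let $\mathcal B^{\rm st}$ be the standard Borel subalgebra, with simple roots $\delta_i-\delta_{i+1}$ $(1\le i<n)$, $\delta_n-\varepsilon_1$, $\varepsilon_j-\varepsilon_{j+1}$ $(1\le j<m)$, $\varepsilon_{m-1}+\varepsilon_m$ (the last being $\delta_n+\varepsilon_1$ if $m=1$, and the last simple root being $2\delta_n$ if $m=0$). For an $(n|m)$-hook partition $\lambda$ (that is, $\lambda_{n+1}\le m$) let $\nu$ be the conjugate of $(\lambda_{n+1},\lambda_{n+2},\dots)$ and put $$\lambda^\#=\sum_{i=1}^n\lambda_i\delta_i+\sum_{j=1}^m\nu_j\varepsilon_j,\qquad \lambda^\#_-=\sum_{i=1}^n\lambda_i\delta_i+\sum_{j=1}^{m-1}\nu_j\varepsilon_j-\nu_m\varepsilon_m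 .$$ Write $L'(\mu)$ for the irreducible $\mathfrak g$-module of highest weight $\mu$ with respect to $\mathcal B^{\rm st}$. A Borel subalgebra $\mathcal B$ is of $|$-shape if some long root $\pm2\delta_i$ is simple for $\mathcal B$, and of $Y$-shape otherwise. Every $\mathcal B$ is described by a signed sequence $x_1,\dots,x_{n+m}$, an arrangement of $\xi_1\delta_{s(1)},\dots,\xi_n\delta_{s(n)}$ and $\eta_1\varepsilon_{t(1)},\dots,\eta_m\varepsilon_{t(m)}$, each family occurring in this order, with permutations $s,t$ and signs $\xi_i,\eta_j\in\{\pm1\}$: the simple roots of $\mathcal B$ are $x_k-x_{k+1}$ $(1\le k<n+m)$, together with $2x_{n+m}$ if the last entry is a $\delta$, or with $x_{n+m-1}+x_{n+m}$ if the last entry is an $\varepsilon$ (and $n+m\ge2$). If $\mathcal B$ is of $Y$-shape, $\eta_m$ is normalised by requiring that the number of negative signs among $\eta_1,\dots,\eta_m$ be even. If $\mathcal B$ is of $|$-shape, put $s(\mathcal B)=\prod_{j=1}^m\eta_j$. The block Frobenius coordinates of $\lambda$ associated to $\mathcal B$ are $p_i=\max\{\lambda_i-e,0\}$, where $e$ is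 the number of $\varepsilon$'s to the left of the $i$-th $\delta$ in the sequence, and $q_j=\max\{\lambda'_j-d,0\}$, where $d$ is the number of $\delta$'s to the left of the $j$-th $\varepsilon$. Put $$\lambda^{\mathcal B}=\sum_{i=1}^n\xi_ip_i\delta_{s(i)}+\sum_{j=1}^m\eta_jq_j\varepsilon_{t(j)},\qquad \lambda^{\mathcal B}_-=\sum_{i=1}^n\xi_ip_i\delta_{s(i)}+\sum_{j=1}^{m-1}\eta_jq_j\varepsilon_{t(j)}-\eta_mq_m\varepsilon_{t(m)} .$$ (If $m=0$, the terms with index $m$ are absent.) Theorem. Let $\lambda$ be an $(n|m)$-hook partition and $\mathcal B$ a Borel subalgebra of $\mathfrak{osp}(2m|2n)$. Then $\mathcal B$ is described by a signed sequence as above, and for every such sequence the following holds. 1. If $\mathcal B$ is of $Y$-shape, then (i) $\lambda^{\mathcal B}$ is the $\mathcal B$-highest weight (the $\mathcal B$-extremal weight) of $L'(\lambda^\#)$, and (ii) $\lambda^{\mathcal B}_-$ is the $\mathcal B$-highest weight of $L'(\lambda^\#_-)$. 2. If $\mathcal B$ is of $|$-shape, then (i) $\lambda^{\mathcal B}$ is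 the $\mathcal B$-highest weight of $L'(\lambda^\#)$ if $s(\mathcal B)=+$, and (ii) $\lambda^{\mathcal B}$ is the $\mathcal B$-highest weight of $L'(\lambda^\#_-)$ if $s(\mathcal B)=-$. -/

import Mathlib

namespace Osp

/-! ### The Lie superalgebra `osp(2m|2n)` -/

/-- Labels of the coordinates of a weight: `inl i` stands for `δ_{i+1}`, `inr j` for `ε_{j+1}`. -/
abbrev Lab (m n : ℕ) : Type := Fin n ⊕ Fin m

/-- Labels of the basis of the natural module `ℂ^{2n|2m}`: the basis vector `v_(a, s)` has
weight `s • a`, so that the weights are `± δ_i` and `± ε_j`. -/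
abbrev Idx (m n : ℕ) : Type := Lab m n × ℤˣ

/-- The sign `(-1)^p` of a parity `p`. -/
noncomputable def sgn (p : ZMod 2) : ℂ := if p = 0 then 1 else -1

/-- The parity of a basis vector: `v_(δ_i, ±)` is odd and `v_(ε_j, ±)` is even. -/
def parity {m n : ℕ} (a : Idx m n) : ZMod 2 :=
  match a.1 with
  | Sum.inl _ => 1
  | Sum.inr _ => 0

/-- The Gram matrix of the standard even non-degenerate supersymmetric bilinear form:
`(v_(a,+) | v_(a,-)) = 1 = (-1)^{|a|} (v_(a,-) | v_(a,+))`, all other pairings of basis vectors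
being zero. -/
noncomputable def gram (m n : ℕ) : Matrix (Idx m n) (Idx m n) ℂ := fun a b =>
  if a.1 = b.1 ∧ a.2 = -b.2 then (if a.2 = 1 then 1 else sgn (parity a)) else 0

/-- The homogeneous elements of parity `p` of `gl(2m|2n)`. -/
def glPart (m n : ℕ) (p : ZMod 2) : Submodule ℂ (Matrix (Idx m n) (Idx m n) ℂ) where
  carrier := {x | ∀ a b, x a b ≠ 0 → parity a + parity b = p}
  add_mem' := by
    intro x y hx hy a b h
    by_cases h1 : x a b = 0
    · refine hy a b fun h2 => h ?_
      simp [h1, h2]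
    · exact hx a b h1
  zero_mem' := by intro a b h; simp at h
  smul_mem' := by
    intro c x hx a b h
    refine hx a b fun h2 => h ?_
    simp [h2]

/-- The elements `x` of `gl(2m|2n)` of parity `p` that preserve the bilinear form:
`(x v_a | v_b) + (-1)^{p |a|} (v_a | x v_b) = 0` for all basis vectors `v_a`, `v_b`. -/
noncomputable def ospPart (m n : ℕ) (p : ZMod 2) :
    Submodule ℂ (Matrix (Idx m n) (Idx m n) ℂ) where
  carrier := {x | x ∈ glPart m n p ∧ ∀ a b,
    (∑ c, x c a * gram m n c b) + sgn (p * parity a) * ∑ c, gram m n a c * x c b = 0}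
  add_mem' := by
    rintro x y ⟨hx, hx'⟩ ⟨hy, hy'⟩
    refine ⟨add_mem hx hy, fun a b => ?_⟩
    have h1 := hx' a b
    have h2 := hy' a b
    simp only [Matrix.add_apply, add_mul, mul_add, Finset.sum_add_distrib]
    linear_combination h1 + h2
  zero_mem' := ⟨zero_mem _, fun a b => by simp⟩
  smul_mem' := by
    rintro c x ⟨hx, hx'⟩
    refine ⟨Submodule.smul_mem _ c hx, fun a b => ?_⟩
    have h1 := hx' a b
    have h2 : (∑ d, (c • x) d a * gram m n d b) = c * ∑ d, x d a * gram m n d b := by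
      rw [Finset.mul_sum]
      exact Finset.sum_congr rfl fun d _ => by simp [mul_assoc]
    have h3 : (∑ d, gram m n a d * (c • x) d b) = c * ∑ d, gram m n a d * x d b := by
      rw [Finset.mul_sum]
      exact Finset.sum_congr rfl fun d _ => by simp; ring
    rw [h2, h3]
    linear_combination c * h1

/-- The underlying space of the Lie superalgebra `osp(2m|2n)`. -/
noncomputable def osp (m n : ℕ) : Submodule ℂ (Matrix (Idx m n) (Idx m n) ℂ) :=
  ospPart m n 0 ⊔ ospPart m n 1

/-- The super bracket `[x, y] = x y - (-1)^{p q} y x` of elements of parities `p` and `q`. -/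
noncomputable def sbracket {m n : ℕ} (p q : ZMod 2) (x y : Matrix (Idx m n) (Idx m n) ℂ) :
    Matrix (Idx m n) (Idx m n) ℂ :=
  x * y - sgn (p * q) • (y * x)

theorem ospPart_le (m n : ℕ) (p : ZMod 2) : ospPart m n p ≤ osp m n := by
  fin_cases p
  · exact le_sup_left
  · exact le_sup_right

theorem sgn_add (p q : ZMod 2) : sgn (p + q) = sgn p * sgn q := by
  have h : ∀ p : ZMod 2, p = 0 ∨ p = 1 := by decide
  have h2 : (1 : ZMod 2) + 1 = 0 := by decide
  rcases h p with rfl | rfl <;> rcases h q with rfl | rfl <;> simp [sgn, h2]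

theorem sgn_mul_self (p : ZMod 2) : sgn p * sgn p = 1 := by
  unfold sgn
  split_ifs <;> norm_num

theorem glPart_mul {m n : ℕ} {p q : ZMod 2} {x y : Matrix (Idx m n) (Idx m n) ℂ}
    (hx : x ∈ glPart m n p) (hy : y ∈ glPart m n q) : x * y ∈ glPart m n (p + q) := by
  intro a b h
  rw [Matrix.mul_apply] at h
  obtain ⟨c, -, hc⟩ := Finset.exists_ne_zero_of_sum_ne_zero h
  have h1 := hx a c (left_ne_zero_of_mul hc)
  have h2 := hy c b (right_ne_zero_of_mul hc)
  rw [← h1, ← h2]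
  have : parity c + parity c = 0 := CharTwo.add_self_eq_zero _
  linear_combination -this

/-- The defining condition of `ospPart` in matrix form. -/
theorem ospPart_iff {m n : ℕ} {p : ZMod 2} {x : Matrix (Idx m n) (Idx m n) ℂ} :
    x ∈ ospPart m n p ↔ x ∈ glPart m n p ∧
      x.transpose * gram m n =
        - (Matrix.diagonal (fun a => sgn (p * parity a)) * (gram m n * x)) := by
  constructor
  · rintro ⟨h1, h2⟩
    refine ⟨h1, ?_⟩
    ext a b
    have := h2 a b
    rw [Matrix.neg_apply, Matrix.diagonal_mul, Matrix.mul_apply, Matrix.mul_apply]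
    simp only [Matrix.transpose_apply]
    linear_combination this
  · rintro ⟨h1, h2⟩
    refine ⟨h1, fun a b => ?_⟩
    have := congrFun (congrFun h2 a) b
    rw [Matrix.neg_apply, Matrix.diagonal_mul, Matrix.mul_apply, Matrix.mul_apply] at this
    simp only [Matrix.transpose_apply] at this
    linear_combination this

theorem transpose_mul_diagonal {m n : ℕ} {q : ZMod 2} (p : ZMod 2)
    {y : Matrix (Idx m n) (Idx m n) ℂ} (hy : y ∈ glPart m n q) :
    y.transpose * Matrix.diagonal (fun a => sgn (p * parity a)) =
      sgn (p * q) • (Matrix.diagonal (fun a => sgn (p * parity a)) * y.transpose) := by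
  ext a b
  rw [Matrix.smul_apply, Matrix.diagonal_mul, Matrix.mul_diagonal, Matrix.transpose_apply]
  by_cases h : y b a = 0
  · simp [h]
  · have h1 := hy b a h
    have h2 : parity a + parity a = 0 := CharTwo.add_self_eq_zero _
    have h3 : parity b = q + parity a := by linear_combination h1 - h2
    rw [h3, mul_add, sgn_add, smul_eq_mul]
    ring

/-- `osp(2m|2n)` is closed under the super bracket. -/
theorem sbracket_mem {m n : ℕ} {p q : ZMod 2} {x y : Matrix (Idx m n) (Idx m n) ℂ}
    (hx : x ∈ ospPart m n p) (hy : y ∈ ospPart m n q) :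
    sbracket p q x y ∈ ospPart m n (p + q) := by
  rw [ospPart_iff] at hx hy ⊢
  obtain ⟨hx1, hx2⟩ := hx
  obtain ⟨hy1, hy2⟩ := hy
  refine ⟨sub_mem (glPart_mul hx1 hy1)
    (Submodule.smul_mem _ _ (by rw [add_comm]; exact glPart_mul hy1 hx1)), ?_⟩
  have hD : Matrix.diagonal (fun a : Idx m n => sgn ((p + q) * parity a)) =
      Matrix.diagonal (fun a : Idx m n => sgn (p * parity a)) *
        Matrix.diagonal (fun a : Idx m n => sgn (q * parity a)) := by
    rw [Matrix.diagonal_mul_diagonal]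
    congr 1
    funext a
    rw [add_mul, sgn_add]
  have hC : Matrix.diagonal (fun a : Idx m n => sgn (q * parity a)) *
      Matrix.diagonal (fun a : Idx m n => sgn (p * parity a)) =
      Matrix.diagonal (fun a : Idx m n => sgn (p * parity a)) *
        Matrix.diagonal (fun a : Idx m n => sgn (q * parity a)) := by
    rw [Matrix.diagonal_mul_diagonal, Matrix.diagonal_mul_diagonal]
    congr 1
    funext a
    rw [mul_comm]
  have hty := transpose_mul_diagonal p hy1
  have htx := transpose_mul_diagonal q hx1
  rw [hD]
  set P := Matrix.diagonal (fun a : Idx m n => sgn (p * parity a))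
  set Q := Matrix.diagonal (fun a : Idx m n => sgn (q * parity a))
  set J := gram m n
  have e1 : (x * y).transpose * J = sgn (p * q) • (P * Q * (J * (y * x))) := by
    calc (x * y).transpose * J = y.transpose * (x.transpose * J) := by
          rw [Matrix.transpose_mul, Matrix.mul_assoc]
      _ = -((y.transpose * P) * (J * x)) := by rw [hx2, Matrix.mul_neg, Matrix.mul_assoc]
      _ = -(sgn (p * q) • (P * ((y.transpose * J) * x))) := by
          rw [hty, Matrix.smul_mul]; simp only [Matrix.mul_assoc]
      _ = sgn (p * q) • (P * Q * (J * (y * x))) := by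
          rw [hy2, Matrix.neg_mul, Matrix.mul_neg, smul_neg, neg_neg]
          simp only [Matrix.mul_assoc]
  have e2 : (y * x).transpose * J = sgn (p * q) • (P * Q * (J * (x * y))) := by
    calc (y * x).transpose * J = x.transpose * (y.transpose * J) := by
          rw [Matrix.transpose_mul, Matrix.mul_assoc]
      _ = -((x.transpose * Q) * (J * y)) := by rw [hy2, Matrix.mul_neg, Matrix.mul_assoc]
      _ = -(sgn (p * q) • (Q * ((x.transpose * J) * y))) := by
          rw [htx, Matrix.smul_mul, mul_comm q p]; simp only [Matrix.mul_assoc]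
      _ = sgn (p * q) • (Q * P * (J * (x * y))) := by
          rw [hx2, Matrix.neg_mul, Matrix.mul_neg, smul_neg, neg_neg]
          simp only [Matrix.mul_assoc]
      _ = _ := by rw [hC]
  rw [sbracket, Matrix.transpose_sub, Matrix.transpose_smul, Matrix.sub_mul, Matrix.smul_mul,
    e1, e2, smul_smul, sgn_mul_self, one_smul, Matrix.mul_sub, Matrix.mul_sub,
    Matrix.mul_smul, Matrix.mul_smul, neg_sub]

/-! ### Cartan subalgebra, roots, positive systems -/

/-- The matrix `H_a = E_{(a,+),(a,+)} - E_{(a,-),(a,-)}`. These matrices form the basis of the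
standard Cartan subalgebra that is dual to the basis `δ_1, …, δ_n, ε_1, …, ε_m` of weights. -/
noncomputable def cartanMat {m n : ℕ} (a : Lab m n) : Matrix (Idx m n) (Idx m n) ℂ :=
  Matrix.diagonal fun b => if b.1 = a then ((b.2 : ℤ) : ℂ) else 0

theorem cartanMat_mem {m n : ℕ} (a : Lab m n) : cartanMat a ∈ ospPart m n 0 := by
  refine ⟨fun b c h => ?_, fun b c => ?_⟩
  · by_cases hbc : b = c
    · subst hbc
      exact CharTwo.add_self_eq_zero _
    · exact absurd (Matrix.diagonal_apply_ne _ hbc) h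
  · have h1 : (∑ d, cartanMat a d b * gram m n d c) = cartanMat a b b * gram m n b c := by
      refine Finset.sum_eq_single b (fun d _ hd => ?_) (by simp)
      rw [cartanMat, Matrix.diagonal_apply_ne _ hd, zero_mul]
    have h2 : (∑ d, gram m n b d * cartanMat a d c) = gram m n b c * cartanMat a c c := by
      refine Finset.sum_eq_single c (fun d _ hd => ?_) (by simp)
      rw [cartanMat, Matrix.diagonal_apply_ne _ hd, mul_zero]
    rw [h1, h2]
    by_cases h : b.1 = c.1 ∧ b.2 = -c.2
    · simp only [cartanMat, Matrix.diagonal_apply_eq, zero_mul]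
      rw [h.1, h.2]
      by_cases hc : c.1 = a <;> simp [hc, sgn]
      ring
    · simp [gram, h]

/-- The Cartan element `H_a` as an element of `osp(2m|2n)`. -/
noncomputable def cartan {m n : ℕ} (a : Lab m n) : osp m n :=
  ⟨cartanMat a, ospPart_le m n 0 (cartanMat_mem a)⟩

/-- Integral weights: the integer combinations of the `δ_i` and `ε_j`, as coefficient functions. -/
abbrev Wt (m n : ℕ) : Type := Lab m n → ℤ

/-- The weight space of weight `α` for the adjoint action of the Cartan subalgebra. -/
noncomputable def rootSpace {m n : ℕ} (α : Wt m n) : Submodule ℂ (osp m n) where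
  carrier := {x | ∀ a, cartanMat a * x.1 - x.1 * cartanMat a = ((α a : ℤ) : ℂ) • x.1}
  add_mem' := by
    intro x y hx hy a
    have h1 := hx a
    have h2 := hy a
    simp only [Submodule.coe_add, Matrix.mul_add, Matrix.add_mul, smul_add]
    rw [← h1, ← h2]
    abel
  zero_mem' := by intro a; simp
  smul_mem' := by
    intro c x hx a
    have h1 := hx a
    simp only [Submodule.coe_smul, Matrix.mul_smul, Matrix.smul_mul]
    rw [← smul_sub, h1, smul_comm]

/-- The set of roots of `osp(2m|2n)`. -/
def roots (m n : ℕ) : Set (Wt m n) := {α | α ≠ 0 ∧ rootSpace α ≠ ⊥}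

/-- Positive systems: the roots on which a linear functional that vanishes on no root is positive.
A Borel subalgebra (containing the standard Cartan subalgebra) is the sum of the Cartan
subalgebra and of the root spaces of a positive system, and will be given by that system. -/
def IsPositiveSystem {m n : ℕ} (P : Set (Wt m n)) : Prop :=
  ∃ f : Wt m n →+ ℝ, (∀ α ∈ roots m n, f α ≠ 0) ∧ P = {α | α ∈ roots m n ∧ 0 < f α}

/-- Simple roots: positive roots that are not the sum of two positive roots. -/
def simpleRoots {m n : ℕ} (P : Set (Wt m n)) : Set (Wt m n) :=
  {α | α ∈ P ∧ ¬ ∃ β ∈ P, ∃ γ ∈ P, α = β + γ}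

/-- The Dynkin diagram is of `|`-shape: some long root `± 2 δ_i` is simple. -/
def IsBarShape {m n : ℕ} (P : Set (Wt m n)) : Prop :=
  ∃ (i : Fin n) (z : ℤˣ), Pi.single (Sum.inl i) (2 * (z : ℤ)) ∈ simpleRoots P

/-- The Dynkin diagram is of `Y`-shape: no long root is simple. -/
def IsYShape {m n : ℕ} (P : Set (Wt m n)) : Prop := ¬ IsBarShape P

/-! ### Signed `εδ`-sequences -/

/-- A signed sequence with indices: an arrangement of `δ_1, …, δ_n, ε_1, …, ε_m` in a row, each
with a sign. The `δ`'s met from left to right are `ξ_1 δ_{s(1)}, …, ξ_n δ_{s(n)}`, the `ε`'s are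
`η_1 ε_{t(1)}, …, η_m ε_{t(m)}`. -/
structure SignedSeq (m n : ℕ) where
  /-- the label in each place -/
  lab : Fin (n + m) ≃ Lab m n
  /-- the sign in each place -/
  sign : Fin (n + m) → ℤˣ

namespace SignedSeq

variable {m n : ℕ}

/-- The signed entry in place `k`, i.e. `ξ_i δ_{s(i)}` or `η_j ε_{t(j)}`, as a weight. -/
def entry (D : SignedSeq m n) (k : Fin (n + m)) : Wt m n :=
  Pi.single (D.lab k) (D.sign k : ℤ)

/-- The simple roots read off from a signed sequence: the differences of neighbours, together with
twice the last entry if this is a `δ`, and the sum of the last two entries if the last one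
is an `ε`. -/
def simple (D : SignedSeq m n) : Set (Wt m n) :=
  {α | ∃ k l : Fin (n + m), (k : ℕ) + 1 = l ∧ α = D.entry k - D.entry l} ∪
  {α | ∃ k : Fin (n + m), (k : ℕ) + 1 = n + m ∧ (D.lab k).isLeft = true ∧
    α = 2 • D.entry k} ∪
  {α | ∃ k l : Fin (n + m), (k : ℕ) + 1 = l ∧ (l : ℕ) + 1 = n + m ∧ (D.lab l).isRight = true ∧
    α = D.entry k + D.entry l}

/-- The number of `δ`'s strictly to the left of place `k`. -/
def deltaBefore (D : SignedSeq m n) (k : Fin (n + m)) : ℕ :=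
  (Finset.univ.filter fun l : Fin (n + m) => l < k ∧ (D.lab l).isLeft = true).card

/-- The number of `ε`'s strictly to the left of place `k`. -/
def epsBefore (D : SignedSeq m n) (k : Fin (n + m)) : ℕ :=
  (Finset.univ.filter fun l : Fin (n + m) => l < k ∧ (D.lab l).isRight = true).card

/-- The product `η_1 ⋯ η_m` of the signs of the `ε`'s. -/
def epsSign (D : SignedSeq m n) : ℤˣ :=
  ∏ k : Fin (n + m), if (D.lab k).isRight = true then D.sign k else 1

/-- The block Frobenius coordinates, arranged along the sequence. If the `i`-th `δ` is in place
`k`, the entry is `p_i = max (λ_i - e, 0)`, where `e` is the number of `ε`'s to its left; if the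
`j`-th `ε` is in place `k`, it is `q_j = max (λ'_j - d, 0)`, where `d` is the number
of `δ`'s to its left. (Rows and columns of a `YoungDiagram` are counted from `0`, and subtraction
of natural numbers is truncated.) -/
def frob (D : SignedSeq m n) (lam : YoungDiagram) (k : Fin (n + m)) : ℕ :=
  match D.lab k with
  | Sum.inl _ => lam.rowLen (D.deltaBefore k) - D.epsBefore k
  | Sum.inr _ => lam.colLen (D.epsBefore k) - D.deltaBefore k

/-- The weight `λ^B = ∑ ξ_i p_i δ_{s(i)} + ∑ η_j q_j ε_{t(j)}`. -/
def weight (D : SignedSeq m n) (lam : YoungDiagram) : Wt m n :=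
  ∑ k, (D.frob lam k : ℤ) • D.entry k

/-- The weight `λ^B_-`, which is `λ^B` with the sign of the term `η_m q_m ε_{t(m)}` reversed. -/
def weightMinus (D : SignedSeq m n) (lam : YoungDiagram) : Wt m n :=
  ∑ k, (if (D.lab k).isRight = true ∧ D.epsBefore k + 1 = m then (-1 : ℤ) else 1) •
    ((D.frob lam k : ℤ) • D.entry k)

/-- The sequence `D` is the one attached to the Borel subalgebra with positive system `P`: the
simple roots are those read off from `D`, and, for diagrams of `Y`-shape (where the sign `η_m` is
not determined by the simple roots), the number of negative signs among the `η_j` is even. -/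
def Describes (D : SignedSeq m n) (P : Set (Wt m n)) : Prop :=
  simpleRoots P = D.simple ∧ (IsYShape P → D.epsSign = 1)

/-- The sequence `δ_1, …, δ_n, ε_1, …, ε_m` with all signs positive. -/
def standard (m n : ℕ) : SignedSeq m n where
  lab := finSumFinEquiv.symm
  sign := fun _ => 1

end SignedSeq

/-- The positive system of the standard Borel subalgebra, i.e. the one with simple roots
`δ_i - δ_{i+1}`, `δ_n - ε_1`, `ε_j - ε_{j+1}`, `ε_{m-1} + ε_m`: the roots that are sums of
these. -/
def standardPos (m n : ℕ) : Set (Wt m n) :=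
  {α | α ∈ roots m n ∧ α ∈ AddSubmonoid.closure (SignedSeq.standard m n).simple}

/-! ### Hook partitions and the weights `λ^#`, `λ^#_-` -/

/-- `(n|m)`-hook partitions: `λ_{n+1} ≤ m`. -/
def IsHook (m n : ℕ) (lam : YoungDiagram) : Prop := lam.rowLen n ≤ m

/-- `λ^# = (λ_1, …, λ_n, ν_1, …, ν_m)`, where `ν` is the conjugate of `(λ_{n+1}, λ_{n+2}, …)`,
so that `ν_j` is the number of cells of `λ` in column `j` below the first `n` rows. -/
def hash (m n : ℕ) (lam : YoungDiagram) : Wt m n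
  | Sum.inl i => lam.rowLen i
  | Sum.inr j => ((lam.cells.filter fun c => n ≤ c.1 ∧ c.2 = (j : ℕ)).card : ℤ)

/-- `λ^#_- = (λ_1, …, λ_n, ν_1, …, ν_{m-1}, -ν_m)`. -/
def hashMinus (m n : ℕ) (lam : YoungDiagram) : Wt m n
  | Sum.inl i => hash m n lam (Sum.inl i)
  | Sum.inr j => if (j : ℕ) + 1 = m then -hash m n lam (Sum.inr j) else hash m n lam (Sum.inr j)

/-! ### Modules -/

/-- The structure of an `osp(2m|2n)`-module (with its `ℤ/2`-grading) on a complex vector space. -/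
structure OspModule (m n : ℕ) (V : Type*) [AddCommGroup V] [Module ℂ V] where
  /-- the even and the odd part -/
  grade : ZMod 2 → Submodule ℂ V
  isInternal : DirectSum.IsInternal grade
  /-- the action -/
  act : osp m n →ₗ[ℂ] Module.End ℂ V
  act_grade : ∀ (p q : ZMod 2) (x : osp m n), x.1 ∈ ospPart m n p →
    ∀ v ∈ grade q, act x v ∈ grade (p + q)
  act_sbracket : ∀ (p q : ZMod 2) (x y : osp m n) (hx : x.1 ∈ ospPart m n p)
    (hy : y.1 ∈ ospPart m n q),
    act ⟨sbracket p q x.1 y.1, ospPart_le m n (p + q) (sbracket_mem hx hy)⟩ =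
      act x * act y - sgn (p * q) • (act y * act x)

namespace OspModule

variable {m n : ℕ} {V : Type*} [AddCommGroup V] [Module ℂ V]

/-- Irreducibility: the module is not zero, and it has no graded submodule other than zero and
itself. -/
def IsIrreducible (M : OspModule m n V) : Prop :=
  Nontrivial V ∧ ∀ W : Submodule ℂ V, W = ⨆ q, W ⊓ M.grade q →
    (∀ x, ∀ w ∈ W, M.act x w ∈ W) → W = ⊥ ∨ W = ⊤

/-- `μ` is a highest weight for the Borel subalgebra with positive system `P`: some non-zero
vector of weight `μ` is killed by all root vectors of positive roots. (In an irreducible module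
such a vector generates the module, so `μ` is the highest weight of the module.) -/
def HasHighestWeight (M : OspModule m n V) (P : Set (Wt m n)) (μ : Wt m n) : Prop :=
  ∃ v : V, v ≠ 0 ∧ (∀ a, M.act (cartan a) v = ((μ a : ℤ) : ℂ) • v) ∧
    ∀ α ∈ P, ∀ x ∈ rootSpace α, M.act x v = 0

/-- `M` is the irreducible module `L'(μ)` with highest weight `μ` for the standard
Borel subalgebra. -/
def IsL' (M : OspModule m n V) (μ : Wt m n) : Prop :=
  M.IsIrreducible ∧ M.HasHighestWeight (standardPos m n) μ

end OspModule

end Osp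

namespace Osp

/-! A positive system is cut out by a functional. Listing the labels by decreasing absolute value of
the functional, with its signs, gives a signed sequence with that positive system (`exists_eq_pos`),
and its simple roots are those read off from the sequence (`simpleRoots_pos`). Passing between
sequences takes two moves: exchanging neighbours, and negating a δ in the last place. Each is the
reflection in a simple root, odd exactly when a δ and an ε are exchanged. Negating an ε in the last
place leaves the positive system unchanged (`pos_flip_last`).

In an irreducible module the highest weight for a given positive system is unique
(`hwVector_unique`): negative root vectors applied to a homogeneous highest weight vector generate a
graded submodule, hence everything. Let `v` be a highest weight vector of weight μ, α the simple
root, `e` and `y` root vectors for α and -α. Powers of `y` applied to `v` are still killed by the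
positive root vectors other than those of α, so any such vector of lower weight that is killed by
`e` too must vanish. For odd α the relation `e y v = χ(μ) v` makes the new highest weight μ or μ - α
according to whether χ(μ) = 0 (`odd_reflection`). For even α the sl₂ computation gives μ - χ(μ)α
when χ(μ) is a natural number (`even_reflection`); integrality comes from the explicit weights, so
finite dimension is not needed.

The Frobenius coordinates obey the same rules. Let d δ's and e ε's precede a neighbouring δ and ε.
If the box in row d, column e (counted from 0) lies outside λ, both coordinates are zero and stay
so; if it lies in λ, the exchange moves one unit from the left entry to the right one
(`frob_swap_diff`). For neighbours of one kind the places keep their coordinates while the labels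
are exchanged, which is the even reflection (`frob_swap_same`).

By rearrangement any label can be brought to the end, so single δ-signs and pairs of ε-signs can be
changed; only the product of the ε-signs is invariant (`hw_weight_of_epsSign_eq`). The standard
sequence realises the product + with λ^#. For m > 0, the same Borel subalgebra described with ε_m
negated realises - with λ^#_-. For Y-shape the last entry is an ε whose sign is free, so one Borel
subalgebra carries both descriptions, and this accounts for λ^B and λ^B_-. -/

variable {m n : ℕ}

/-! ### Weights of the natural module and the invariant form -/

/-- The index of the basis vector whose weight is opposite. -/
def bar (a : Idx m n) : Idx m n := (a.1, -a.2)

@[simp] theorem bar_bar (a : Idx m n) : bar (bar a) = a := by simp [bar]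
@[simp] theorem bar_fst (a : Idx m n) : (bar a).1 = a.1 := rfl
@[simp] theorem bar_snd (a : Idx m n) : (bar a).2 = -a.2 := rfl
@[simp] theorem parity_bar (a : Idx m n) : parity (bar a) = parity a := rfl

theorem bar_eq_iff {a b : Idx m n} : bar a = b ↔ a = bar b :=
  ⟨fun h => by rw [← h, bar_bar], fun h => by rw [h, bar_bar]⟩

theorem bar_ne (a : Idx m n) : bar a ≠ a := by
  intro h
  have h2 := congrArg Prod.snd h
  rcases Int.units_eq_one_or a.2 with h1 | h1 <;> simp [h1] at h2

theorem eq_or_eq_bar {a b : Idx m n} (h : a.1 = b.1) : a = b ∨ a = bar b := by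
  by_cases h2 : a.2 = b.2
  · exact Or.inl (Prod.ext h h2)
  · exact Or.inr (Prod.ext h (Int.units_ne_iff_eq_neg.1 h2))

/-- The weight of a basis vector of the natural module. -/
def wt (a : Idx m n) : Wt m n := Pi.single a.1 (a.2 : ℤ)

@[simp] theorem wt_bar (a : Idx m n) : wt (bar a) = -wt a := by
  simp [wt, bar, Pi.single_neg]

theorem wt_apply (a : Idx m n) (c : Lab m n) : wt a c = if c = a.1 then (a.2 : ℤ) else 0 := by
  simp [wt, Pi.single_apply]

/-- The parity of a weight, additive in the weight. -/
def par : Wt m n →+ ZMod 2 where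
  toFun γ := ((∑ i, γ (Sum.inl i) : ℤ) : ZMod 2)
  map_zero' := by simp
  map_add' := by intro x y; simp [Finset.sum_add_distrib]

theorem par_wt (a : Idx m n) : par (wt a) = parity a := by
  obtain ⟨a | a, s⟩ := a
  · rcases Int.units_eq_one_or s with rfl | rfl <;>
      simp [par, wt, parity, Pi.single_apply]
  · simp [par, wt, parity]

theorem par_neg (α : Wt m n) : par (-α) = par α := by
  rw [map_neg]; exact ZMod.neg_eq_self_mod_two _

theorem par_wt_sub (a b : Idx m n) : par (wt a - wt b) = parity a + parity b := by
  rw [map_sub, par_wt, par_wt, sub_eq_add_neg, ZMod.neg_eq_self_mod_two]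

/-- The value of the form on `v_a` and the vector of opposite weight. -/
noncomputable def gsign (a : Idx m n) : ℂ := if a.2 = 1 then 1 else sgn (parity a)

theorem gram_eq (a b : Idx m n) : gram m n a b = if b = bar a then gsign a else 0 := by
  have : (a.1 = b.1 ∧ a.2 = -b.2) ↔ b = bar a := by
    rw [Prod.ext_iff, bar_fst, bar_snd, eq_comm, ← neg_eq_iff_eq_neg, eq_comm (a := -a.2)]
  simp only [gram, this, gsign]

theorem gsign_mul_self (a : Idx m n) : gsign a * gsign a = 1 := by
  unfold gsign; split_ifs
  · simp
  · exact sgn_mul_self _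

theorem gsign_mul_bar (a : Idx m n) : gsign a * gsign (bar a) = sgn (parity a) := by
  have h : (-1 : ℤˣ) ≠ 1 := by decide
  unfold gsign
  rcases Int.units_eq_one_or a.2 with h1 | h1 <;> simp [h1, h]

/-- The condition for preserving the form, in terms of pairs of entries. -/
theorem mem_ospPart_iff {p : ZMod 2} {x : Matrix (Idx m n) (Idx m n) ℂ} :
    x ∈ ospPart m n p ↔ x ∈ glPart m n p ∧
      ∀ i j, x (bar j) (bar i) = -(sgn (p * parity j) * gsign i * gsign j) * x i j := by
  have key : ∀ a b, ((∑ c, x c a * gram m n c b) + sgn (p * parity a) *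
      ∑ c, gram m n a c * x c b) =
      x (bar b) a * gsign (bar b) + sgn (p * parity a) * (gsign a * x (bar a) b) := by
    intro a b
    congr 1
    · rw [Finset.sum_eq_single (bar b)]
      · simp [gram_eq]
      · intro c _ hc
        have : b ≠ bar c := fun h => hc (by rw [h, bar_bar])
        simp [gram_eq, this]
      · simp
    · congr 1
      rw [Finset.sum_eq_single (bar a)]
      · simp [gram_eq]
      · intro c _ hc
        simp [gram_eq, hc]
      · simp
  constructor
  · rintro ⟨h1, h2⟩
    refine ⟨h1, fun i j => ?_⟩
    have h := h2 j (bar i)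
    rw [key, bar_bar] at h
    have s1 := sgn_mul_self (p * parity j)
    have s2 := gsign_mul_self j
    linear_combination (sgn (p * parity j) * gsign j) * h
      - (gsign j * gsign j * x (bar j) (bar i)) * s1 - x (bar j) (bar i) * s2
  · rintro ⟨h1, h2⟩
    refine ⟨h1, fun a b => ?_⟩
    rw [key]
    have h := h2 (bar b) a
    rw [bar_bar] at h
    rw [h]
    have s1 := sgn_mul_self (p * parity a)
    have s2 := gsign_mul_self a
    linear_combination (-(gsign a * gsign a) * gsign (bar b) * x (bar b) a) * s1
      - gsign (bar b) * x (bar b) a * s2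

/-! ### Root spaces in terms of matrix entries -/

theorem zmod2_cases (p : ZMod 2) : p = 0 ∨ p = 1 := by revert p; decide

theorem mem_rootSpace_iff {α : Wt m n} {x : osp m n} :
    x ∈ rootSpace α ↔ ∀ i j, x.1 i j ≠ 0 → wt i - wt j = α := by
  have key : ∀ a i j, (cartanMat a * x.1 - x.1 * cartanMat a) i j =
      (((wt i - wt j) a : ℤ) : ℂ) * x.1 i j := by
    intro a i j
    rw [Matrix.sub_apply, cartanMat, Matrix.diagonal_mul, Matrix.mul_diagonal, Pi.sub_apply,
      wt_apply, wt_apply]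
    simp only [eq_comm (a := a)]
    push_cast
    ring
  constructor
  · intro h i j hij
    funext a
    have h1 := congrFun (congrFun (h a) i) j
    rw [key, Matrix.smul_apply, smul_eq_mul] at h1
    exact_mod_cast mul_right_cancel₀ hij h1
  · intro h a
    ext i j
    rw [key, Matrix.smul_apply, smul_eq_mul]
    by_cases hij : x.1 i j = 0
    · simp [hij]
    · rw [h i j hij]

/-- The weight of a matrix place determines its parity, so in the decomposition of a root vector
into even and odd part one part must vanish. -/
theorem rootSpace_mem_ospPart {α : Wt m n} {x : osp m n} (hx : x ∈ rootSpace α) :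
    x.1 ∈ ospPart m n (par α) := by
  rw [mem_rootSpace_iff] at hx
  obtain ⟨y, hy, z, hz, hyz⟩ := Submodule.mem_sup.1 x.2
  have e : ∀ i j, x.1 i j = y i j + z i j := fun i j => by rw [← hyz]; rfl
  have hp : ∀ i j, y i j + z i j ≠ 0 → par α = parity i + parity j := fun i j h => by
    rw [← hx i j (by rwa [e]), par_wt_sub]
  have h01 : (0 : ZMod 2) ≠ 1 := by decide
  rcases zmod2_cases (par α) with h | h
  · rw [h] at hp ⊢
    have : z = 0 := by
      ext i j
      by_contra hne
      have h1 := hz.1 i j hne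
      have h2 : y i j = 0 := by
        by_contra h3
        exact h01 ((hy.1 i j h3).symm.trans h1)
      exact h01 ((hp i j (by simpa [h2] using hne)).trans h1)
    rw [← hyz, this, add_zero]; exact hy
  · rw [h] at hp ⊢
    have : y = 0 := by
      ext i j
      by_contra hne
      have h1 := hy.1 i j hne
      have h2 : z i j = 0 := by
        by_contra h3
        exact h01 (h1.symm.trans (hz.1 i j h3))
      exact h01 (h1.symm.trans (hp i j (by simpa [h2] using hne)).symm)
    rw [← hyz, this, zero_add]; exact hz

/-- The component of weight `γ` of a matrix. -/
noncomputable def comp (γ : Wt m n) (x : Matrix (Idx m n) (Idx m n) ℂ) :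
    Matrix (Idx m n) (Idx m n) ℂ :=
  fun i j => if wt i - wt j = γ then x i j else 0

theorem comp_mem {p : ZMod 2} {x : Matrix (Idx m n) (Idx m n) ℂ} (hx : x ∈ ospPart m n p)
    (γ : Wt m n) : comp γ x ∈ ospPart m n p := by
  rw [mem_ospPart_iff] at hx ⊢
  refine ⟨fun a b h => hx.1 a b fun h2 => h (by simp [comp, h2]), fun i j => ?_⟩
  have h : wt (bar j) - wt (bar i) = wt i - wt j := by rw [wt_bar, wt_bar]; abel
  simp only [comp, h]
  split_ifs
  · exact hx.2 i j
  · simp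

/-- The invariance condition relates the place (i, j) only to (bar j, bar i), which has the same
weight. Hence the weight components of an element of the algebra lie in the algebra. -/
theorem iSup_rootSpace : (⨆ α : Wt m n, rootSpace α) = ⊤ := by
  rw [eq_top_iff]
  have key : ∀ p, ∀ x, ∀ hx : x ∈ ospPart m n p,
      (⟨x, ospPart_le m n p hx⟩ : osp m n) ∈ ⨆ α : Wt m n, rootSpace α := by
    intro p x hx
    have : (⟨x, ospPart_le m n p hx⟩ : osp m n) =
        ∑ γ ∈ Finset.univ.image (fun q : Idx m n × Idx m n => wt q.1 - wt q.2),
          ⟨comp γ x, ospPart_le m n p (comp_mem hx γ)⟩ := by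
      apply Subtype.ext
      rw [AddSubmonoidClass.coe_finsetSum]
      ext i j
      rw [Matrix.sum_apply]
      simp only [comp]
      rw [Finset.sum_ite_eq, if_pos]
      exact Finset.mem_image_of_mem (fun q : Idx m n × Idx m n => wt q.1 - wt q.2)
        (Finset.mem_univ (i, j))
    rw [this]
    refine Submodule.sum_mem _ fun γ _ => Submodule.mem_iSup_of_mem γ ?_
    rw [mem_rootSpace_iff]
    intro i j h
    by_contra h2
    exact h (if_neg h2)
  rintro ⟨x, hx⟩ -
  obtain ⟨y, hy, z, hz, rfl⟩ := Submodule.mem_sup.1 hx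
  exact add_mem (key 0 y hy) (key 1 z hz)

theorem wt_injective : Function.Injective (wt : Idx m n → Wt m n) := by
  intro a b h
  have h1 := congrFun h a.1
  rw [wt_apply, wt_apply, if_pos rfl] at h1
  split_ifs at h1 with h2
  · exact Prod.ext h2 (Units.ext h1)
  · exact absurd h1 a.2.ne_zero

/-- A short root occurs in exactly two matrix places, exchanged by the form; this is why its root
space is one-dimensional. -/
theorem wt_sub_eq_iff {a b i j : Idx m n} (hab : a.1 ≠ b.1) (h : wt i - wt j = wt a - wt b) :
    (i = a ∧ j = b) ∨ (i = bar b ∧ j = bar a) := by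
  have ha := congrFun h a.1
  have hb := congrFun h b.1
  simp only [Pi.sub_apply, wt_apply, if_neg hab, if_neg hab.symm, if_true] at ha hb
  have ua := a.2.ne_zero
  have ub := b.2.ne_zero
  by_cases h1 : a.1 = i.1
  · have h1b : ¬ b.1 = i.1 := fun h2 => hab (h1.trans h2.symm)
    rw [if_neg h1b] at hb
    by_cases h2 : b.1 = j.1
    · have h2a : ¬ a.1 = j.1 := fun h3 => hab (h3.trans h2.symm)
      rw [if_pos h1, if_neg h2a] at ha
      rw [if_pos h2] at hb
      exact Or.inl ⟨Prod.ext h1.symm (Units.ext (by linarith)),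
        Prod.ext h2.symm (Units.ext (by linarith))⟩
    · rw [if_neg h2] at hb
      exact absurd (by linarith) ub
  · rw [if_neg h1] at ha
    by_cases h2 : a.1 = j.1
    · have h2b : ¬ b.1 = j.1 := fun h3 => hab (h2.trans h3.symm)
      rw [if_pos h2] at ha
      rw [if_neg h2b] at hb
      by_cases h3 : b.1 = i.1
      · rw [if_pos h3] at hb
        refine Or.inr ⟨Prod.ext h3.symm (Units.ext ?_), Prod.ext h2.symm (Units.ext ?_)⟩
        · rw [bar_snd, Units.val_neg]; linarith
        · rw [bar_snd, Units.val_neg]; linarith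
      · rw [if_neg h3] at hb
        exact absurd (by linarith) ub
    · rw [if_neg h2] at ha
      exact absurd (by linarith) ua

theorem wt_sub_eq_long_iff {a i j : Idx m n} (h : wt i - wt j = wt a - wt (bar a)) :
    i = a ∧ j = bar a := by
  have ha := congrFun h a.1
  rw [wt_bar] at ha
  simp only [Pi.sub_apply, Pi.neg_apply, wt_apply, if_true] at ha
  have ui : ((i.2 : ℤˣ) : ℤ) = 1 ∨ ((i.2 : ℤˣ) : ℤ) = -1 := Int.isUnit_iff.1 i.2.isUnit
  have uj : ((j.2 : ℤˣ) : ℤ) = 1 ∨ ((j.2 : ℤˣ) : ℤ) = -1 := Int.isUnit_iff.1 j.2.isUnit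
  have ua : ((a.2 : ℤˣ) : ℤ) = 1 ∨ ((a.2 : ℤˣ) : ℤ) = -1 := Int.isUnit_iff.1 a.2.isUnit
  split_ifs at ha with h1 h2 h2
  · refine ⟨Prod.ext h1.symm (Units.ext (by omega)), Prod.ext h2.symm (Units.ext ?_)⟩
    rw [bar_snd, Units.val_neg]; omega
  all_goals omega

/-! ### Root vectors and the set of roots -/

/-- The coefficient relating the entries `(a, b)` and `(bar b, bar a)` of an element of `osp`. -/
noncomputable def coef (a b : Idx m n) : ℂ :=
  -(sgn ((parity a + parity b) * parity b) * gsign a * gsign b)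

theorem sgn_sq_add (p q : ZMod 2) :
    sgn ((p + q) * p) * sgn ((p + q) * q) * sgn p * sgn q = 1 := by
  have h : (1 : ZMod 2) + 1 = 0 := by decide
  rcases zmod2_cases p with rfl | rfl <;> rcases zmod2_cases q with rfl | rfl <;> simp [sgn, h]

/-- Exchanging the two places of a short root twice is the identity, so the two invariance
conditions agree and a non-zero root vector exists. -/
theorem coef_mul_coef (a b : Idx m n) : coef a b * coef (bar b) (bar a) = 1 := by
  have h1 := gsign_mul_bar a
  have h2 := gsign_mul_bar b
  have h3 := sgn_sq_add (parity a) (parity b)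
  simp only [coef, parity_bar]
  rw [add_comm (parity b) (parity a)]
  calc _ = sgn ((parity a + parity b) * parity a) * sgn ((parity a + parity b) * parity b) *
        (gsign a * gsign (bar a)) * (gsign b * gsign (bar b)) := by ring
    _ = 1 := by rw [h1, h2]; exact h3

theorem entry_bar {a b : Idx m n} {α : Wt m n} {x : osp m n} (hx : x ∈ rootSpace α) :
    x.1 (bar b) (bar a) = coef a b * x.1 a b := by
  have h := (mem_ospPart_iff.1 (rootSpace_mem_ospPart hx)).2 a b
  by_cases h0 : x.1 a b = 0
  · rw [h, h0, mul_zero, mul_zero]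
  · rw [h, coef, ← par_wt_sub, mem_rootSpace_iff.1 hx a b h0]

/-- A short root vector, as a matrix. -/
noncomputable def shortMat (a b : Idx m n) : Matrix (Idx m n) (Idx m n) ℂ := fun i j =>
  if i = a ∧ j = b then 1 else if i = bar b ∧ j = bar a then coef a b else 0

theorem shortMat_mem {a b : Idx m n} (hab : a.1 ≠ b.1) :
    shortMat a b ∈ ospPart m n (parity a + parity b) := by
  have hne : ∀ c : Idx m n, c.1 = a.1 → c.1 = b.1 → False := fun c h1 h2 => hab (h1.symm.trans h2)
  rw [mem_ospPart_iff]
  refine ⟨fun i j h => ?_, fun i j => ?_⟩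
  · unfold shortMat at h
    split_ifs at h with h1 h2
    · rw [h1.1, h1.2]
    · rw [h2.1, h2.2, parity_bar, parity_bar, add_comm]
    · exact absurd rfl h
  · unfold shortMat
    by_cases h1 : i = a ∧ j = b
    · obtain ⟨rfl, rfl⟩ := h1
      have h0 : ¬ (bar j = i ∧ bar i = j) := fun h => hab (congrArg Prod.fst h.1).symm
      rw [if_neg h0, if_pos ⟨rfl, rfl⟩, if_pos ⟨rfl, rfl⟩, coef, mul_one]
    · rw [if_neg h1]
      by_cases h2 : i = bar b ∧ j = bar a
      · obtain ⟨rfl, rfl⟩ := h2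
        rw [if_pos ⟨bar_bar a, bar_bar b⟩, if_pos ⟨rfl, rfl⟩, ← coef_mul_coef a b, mul_comm]
        simp [coef, add_comm]
      · rw [if_neg h2, if_neg, if_neg, mul_zero]
        · rw [bar_eq_iff, bar_eq_iff, bar_bar, bar_bar]; tauto
        · rw [bar_eq_iff, bar_eq_iff]; tauto

/-- A long root vector, as a matrix. -/
noncomputable def longMat (a : Idx m n) : Matrix (Idx m n) (Idx m n) ℂ := fun i j =>
  if i = a ∧ j = bar a then 1 else 0

/-- The place (a, bar a) is paired with itself, and invariance multiplies its entry by minus the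
sign of the parity of `a`. This factor is 1 for a δ. -/
theorem longMat_mem {a : Idx m n} (ha : a.1.isLeft = true) : longMat a ∈ ospPart m n 0 := by
  have hp : parity a = 1 := by
    obtain ⟨a | a, s⟩ := a
    · rfl
    · simp at ha
  rw [mem_ospPart_iff]
  refine ⟨fun i j h => ?_, fun i j => ?_⟩
  · unfold longMat at h
    split_ifs at h with h1
    · rw [h1.1, h1.2, parity_bar]; exact CharTwo.add_self_eq_zero _
    · exact absurd rfl h
  · unfold longMat
    by_cases h1 : i = a ∧ j = bar a
    · obtain ⟨rfl, rfl⟩ := h1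
      have := gsign_mul_bar i
      rw [hp] at this
      rw [if_pos ⟨bar_bar _, rfl⟩, if_pos ⟨rfl, rfl⟩, zero_mul, mul_assoc, this]
      simp [sgn]
    · rw [if_neg h1, if_neg, mul_zero]
      rw [bar_eq_iff, bar_eq_iff, bar_bar]; tauto

/-- The root `wt a - wt b` has a root vector with entry `1` in place `(a, b)`, which spans the
root space. -/
theorem exists_rootVector {a b : Idx m n} (hab : a.1 ≠ b.1 ∨ (b = bar a ∧ a.1.isLeft = true)) :
    ∃ e ∈ rootSpace (wt a - wt b), e.1 a b = 1 ∧
      ∀ x ∈ rootSpace (wt a - wt b), x = x.1 a b • e := by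
  rcases hab with hab | ⟨rfl, ha⟩
  · have hm : (⟨shortMat a b, ospPart_le _ _ _ (shortMat_mem hab)⟩ : osp m n) ∈
        rootSpace (wt a - wt b) := by
      rw [mem_rootSpace_iff]
      intro i j h
      change shortMat a b i j ≠ 0 at h
      unfold shortMat at h
      split_ifs at h with h1 h2
      · rw [h1.1, h1.2]
      · rw [h2.1, h2.2, wt_bar, wt_bar]; abel
      · exact absurd rfl h
    have h1 : shortMat a b a b = 1 := if_pos ⟨rfl, rfl⟩
    refine ⟨_, hm, h1, fun x hx => Subtype.ext ?_⟩
    ext i j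
    change x.1 i j = x.1 a b * shortMat a b i j
    by_cases hij : wt i - wt j = wt a - wt b
    · rcases wt_sub_eq_iff hab hij with ⟨rfl, rfl⟩ | ⟨rfl, rfl⟩
      · rw [h1, mul_one]
      · have := entry_bar (a := a) (b := b) hm
        change shortMat a b _ _ = _ * shortMat a b _ _ at this
        rw [entry_bar hx, this, h1]; ring
    · rw [mem_rootSpace_iff] at hx hm
      have hm0 : shortMat a b i j = 0 := not_imp_comm.1 (hm i j) hij
      rw [not_imp_comm.1 (hx i j) hij, hm0, mul_zero]
  · have hm : (⟨longMat a, ospPart_le _ _ _ (longMat_mem ha)⟩ : osp m n) ∈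
        rootSpace (wt a - wt (bar a)) := by
      rw [mem_rootSpace_iff]
      intro i j h
      change longMat a i j ≠ 0 at h
      unfold longMat at h
      split_ifs at h with h1
      · rw [h1.1, h1.2]
      · exact absurd rfl h
    have h1 : longMat a a (bar a) = 1 := if_pos ⟨rfl, rfl⟩
    refine ⟨_, hm, h1, fun x hx => Subtype.ext ?_⟩
    ext i j
    change x.1 i j = x.1 a (bar a) * longMat a i j
    by_cases hij : wt i - wt j = wt a - wt (bar a)
    · obtain ⟨rfl, rfl⟩ := wt_sub_eq_long_iff hij
      rw [h1, mul_one]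
    · rw [mem_rootSpace_iff] at hx hm
      have hm0 : longMat a i j = 0 := not_imp_comm.1 (hm i j) hij
      rw [not_imp_comm.1 (hx i j) hij, hm0, mul_zero]

theorem mem_roots_iff {α : Wt m n} : α ∈ roots m n ↔
    ∃ a b : Idx m n, α = wt a - wt b ∧ (a.1 ≠ b.1 ∨ (b = bar a ∧ a.1.isLeft = true)) := by
  constructor
  · rintro ⟨h0, h⟩
    obtain ⟨x, hx, hx0⟩ := (Submodule.ne_bot_iff _).1 h
    have : ∃ i j, x.1 i j ≠ 0 := by
      by_contra! hc
      exact hx0 (Subtype.ext (Matrix.ext hc))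
    obtain ⟨i, j, hij⟩ := this
    have hα := mem_rootSpace_iff.1 hx i j hij
    refine ⟨i, j, hα.symm, ?_⟩
    by_cases h1 : i.1 = j.1
    · right
      rcases eq_or_eq_bar h1.symm with h2 | h2
      · rw [h2, sub_self] at hα
        exact absurd hα.symm h0
      · refine ⟨h2, ?_⟩
        by_contra h3
        have hp : parity i = 0 := by
          obtain ⟨a | a, s⟩ := i
          · simp at h3
          · rfl
        -- For an ε the self-paired place carries the factor -1, so its entry vanishes: ±2ε is not a
        -- root.
        have h4 := entry_bar (a := i) (b := bar i) hx
        rw [bar_bar, coef, mul_assoc, gsign_mul_bar, parity_bar, hp, ← h2] at h4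
        simp only [sgn, add_zero, mul_zero, if_true, mul_one, neg_mul, one_mul] at h4
        exact hij (self_eq_neg.1 h4)
    · exact Or.inl h1
  · rintro ⟨a, b, rfl, hab⟩
    obtain ⟨e, he, h1, -⟩ := exists_rootVector hab
    refine ⟨fun h => ?_, fun h => ?_⟩
    · have := wt_injective (sub_eq_zero.1 h)
      rcases hab with h2 | ⟨h2, -⟩
      · exact h2 (by rw [this])
      · exact bar_ne a (h2.symm.trans this.symm)
    · rw [h, Submodule.mem_bot] at he
      rw [he] at h1
      simp at h1

theorem roots_finite : (roots m n).Finite := by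
  refine (Set.finite_range fun q : Idx m n × Idx m n => wt q.1 - wt q.2).subset ?_
  intro α hα
  obtain ⟨a, b, rfl, -⟩ := mem_roots_iff.1 hα
  exact ⟨(a, b), rfl⟩

theorem rootSpace_eq_zero {α : Wt m n} (h0 : α ≠ 0) (hα : α ∉ roots m n) {x : osp m n}
    (hx : x ∈ rootSpace α) : x = 0 := by
  have : rootSpace α = ⊥ := by
    by_contra h
    exact hα ⟨h0, h⟩
  rwa [this, Submodule.mem_bot] at hx

theorem neg_mem_roots {α : Wt m n} (h : α ∈ roots m n) : -α ∈ roots m n := by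
  obtain ⟨a, b, rfl, hab⟩ := mem_roots_iff.1 h
  refine mem_roots_iff.2 ⟨b, a, by abel, ?_⟩
  rcases hab with h1 | ⟨rfl, h1⟩
  · exact Or.inl h1.symm
  · exact Or.inr ⟨(bar_bar a).symm, h1⟩

/-- This ensures both that the square of an odd root vector acts by zero and that subtracting a
simple root α from another positive root never yields α again. -/
theorem two_smul_notMem_roots {α : Wt m n} (h : α ∈ roots m n) : α + α ∉ roots m n := by
  obtain ⟨a, b, rfl, hab⟩ := mem_roots_iff.1 h
  intro h2
  obtain ⟨i, j, hij, h3⟩ := mem_roots_iff.1 h2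
  have ha := congrFun hij a.1
  have ua : ((a.2 : ℤˣ) : ℤ) = 1 ∨ ((a.2 : ℤˣ) : ℤ) = -1 := Int.isUnit_iff.1 a.2.isUnit
  have ui : ((i.2 : ℤˣ) : ℤ) = 1 ∨ ((i.2 : ℤˣ) : ℤ) = -1 := Int.isUnit_iff.1 i.2.isUnit
  have uj : ((j.2 : ℤˣ) : ℤ) = 1 ∨ ((j.2 : ℤˣ) : ℤ) = -1 := Int.isUnit_iff.1 j.2.isUnit
  rcases hab with hab | ⟨rfl, -⟩
  · have hb := congrFun hij b.1
    simp only [Pi.sub_apply, Pi.add_apply, wt_apply, if_neg hab, if_neg hab.symm, if_true] at ha hb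
    have ub : ((b.2 : ℤˣ) : ℤ) = 1 ∨ ((b.2 : ℤˣ) : ℤ) = -1 := Int.isUnit_iff.1 b.2.isUnit
    split_ifs at ha hb with g1 g2 g3 g4 g5 g6
    all_goals first | omega | exact hab (by simp_all)
  · simp only [Pi.sub_apply, Pi.add_apply, wt_apply, wt_bar, Pi.neg_apply, if_true] at ha
    split_ifs at ha <;> omega

/-! ### Weight zero elements and brackets of root vectors -/

theorem cartan_mem_rootSpace (a : Lab m n) : cartan a ∈ rootSpace (0 : Wt m n) := by
  rw [mem_rootSpace_iff]
  intro i j h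
  by_cases hij : i = j
  · rw [hij, sub_self]
  · exact absurd (Matrix.diagonal_apply_ne _ hij) h

/-- The weight zero space is spanned by the Cartan elements. -/
theorem rootSpace_zero {z : osp m n} (hz : z ∈ rootSpace 0) :
    z = ∑ c : Lab m n, z.1 (c, 1) (c, 1) • cartan c := by
  apply Subtype.ext
  rw [AddSubmonoidClass.coe_finsetSum]
  ext i j
  rw [Matrix.sum_apply]
  change z.1 i j = ∑ c, z.1 (c, 1) (c, 1) * cartanMat c i j
  by_cases hij : i = j
  · subst hij
    simp only [cartanMat, Matrix.diagonal_apply_eq]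
    rw [Finset.sum_eq_single i.1]
    · rw [if_pos rfl]
      rcases Int.units_eq_one_or i.2 with h | h
      · have : i = (i.1, 1) := Prod.ext rfl h
        rw [← this, h]; simp
      · have h2 : i = bar (i.1, 1) := Prod.ext rfl h
        have h1 := entry_bar (a := (i.1, 1)) (b := (i.1, 1)) hz
        rw [← h2] at h1
        rw [h1, h, coef, mul_assoc, gsign_mul_self, CharTwo.add_self_eq_zero]
        simp [sgn]
    · intro c _ hc
      rw [if_neg hc.symm, mul_zero]
    · simp
  · have : z.1 i j = 0 := by
      by_contra h
      exact hij (wt_injective (sub_eq_zero.1 (mem_rootSpace_iff.1 hz i j h)))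
    rw [this, Finset.sum_eq_zero]
    intro c _
    rw [cartanMat, Matrix.diagonal_apply_ne _ hij, mul_zero]

/-- The super bracket of two root vectors. -/
theorem bracket_mem {α β : Wt m n} {x y : osp m n} (hx : x ∈ rootSpace α)
    (hy : y ∈ rootSpace β) :
    (⟨sbracket (par α) (par β) x.1 y.1, ospPart_le m n _
      (sbracket_mem (rootSpace_mem_ospPart hx) (rootSpace_mem_ospPart hy))⟩ : osp m n) ∈
      rootSpace (α + β) := by
  rw [mem_rootSpace_iff] at hx hy ⊢
  intro i j h
  have key : ∀ {x y : osp m n} {α β : Wt m n}, (∀ i j, x.1 i j ≠ 0 → wt i - wt j = α) →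
      (∀ i j, y.1 i j ≠ 0 → wt i - wt j = β) → (x.1 * y.1) i j ≠ 0 →
      wt i - wt j = α + β := by
    intro x y α β hx hy h
    rw [Matrix.mul_apply] at h
    obtain ⟨c, -, hc⟩ := Finset.exists_ne_zero_of_sum_ne_zero h
    rw [← hx i c (left_ne_zero_of_mul hc), ← hy c j (right_ne_zero_of_mul hc)]
    abel
  by_cases h1 : (x.1 * y.1) i j = 0
  · rw [add_comm]
    refine key hy hx fun h2 => h ?_
    change (x.1 * y.1 - _ • (y.1 * x.1)) i j = 0
    rw [Matrix.sub_apply, Matrix.smul_apply, h1, h2, smul_zero, sub_zero]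
  · exact key hx hy h1

/-- The roots on which a functional is positive. -/
def posSys (f : Wt m n →+ ℝ) : Set (Wt m n) := {α | α ∈ roots m n ∧ 0 < f α}

theorem map_eq_sum_single (f : Wt m n →+ ℝ) (ν : Wt m n) :
    f ν = ∑ a, (ν a : ℝ) * f (Pi.single a 1) := by
  conv_lhs => rw [← Finset.univ_sum_single ν]
  rw [map_sum]
  refine Finset.sum_congr rfl fun a _ => ?_
  have : (Pi.single a (ν a) : Wt m n) = ν a • Pi.single a 1 := by
    rw [← Pi.single_smul, smul_eq_mul, mul_one]
  rw [this, map_zsmul, zsmul_eq_mul]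

/-! ### Weight spaces and homogeneous highest weight vectors -/

namespace OspModule

variable {V : Type*} [AddCommGroup V] [Module ℂ V] (M : OspModule m n V)

/-- The weight space of weight `ν` of a module. -/
noncomputable def wtSpace (ν : Wt m n) : Submodule ℂ V where
  carrier := {w | ∀ a, M.act (cartan a) w = ((ν a : ℤ) : ℂ) • w}
  add_mem' := by
    intro v w hv hw a
    rw [map_add, hv a, hw a, smul_add]
  zero_mem' := by intro a; simp
  smul_mem' := by
    intro c w hw a
    rw [map_smul, hw a, smul_comm]

theorem act_comm {α β : Wt m n} {x y : osp m n} (hx : x ∈ rootSpace α) (hy : y ∈ rootSpace β) :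
    ∃ z ∈ rootSpace (α + β), z.1 = sbracket (par α) (par β) x.1 y.1 ∧ ∀ w,
      M.act x (M.act y w) = M.act z w + sgn (par α * par β) • M.act y (M.act x w) := by
  refine ⟨_, bracket_mem hx hy, rfl, fun w => ?_⟩
  rw [M.act_sbracket (par α) (par β) x y (rootSpace_mem_ospPart hx) (rootSpace_mem_ospPart hy)]
  simp [Module.End.mul_apply]

theorem act_mem_wtSpace {α ν : Wt m n} {x : osp m n} (hx : x ∈ rootSpace α) {w : V}
    (hw : w ∈ M.wtSpace ν) : M.act x w ∈ M.wtSpace (α + ν) := by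
  intro a
  obtain ⟨z, -, hz, h⟩ := M.act_comm (cartan_mem_rootSpace a) hx
  have hz2 : z = ((α a : ℤ) : ℂ) • x := by
    apply Subtype.ext
    rw [hz, map_zero, sbracket, zero_mul, Submodule.coe_smul, ← hx a]
    simp [sgn, cartan]
  rw [h, hz2, hw a, map_zero, zero_mul]
  simp [sgn, add_smul]

/-- A weight zero element acts on a weight space by a scalar. -/
theorem act_zero_weight {z : osp m n} (hz : z ∈ rootSpace 0) {ν : Wt m n} {w : V}
    (hw : w ∈ M.wtSpace ν) :
    M.act z w = (∑ c : Lab m n, z.1 (c, 1) (c, 1) * ((ν c : ℤ) : ℂ)) • w := by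
  conv_lhs => rw [rootSpace_zero hz]
  rw [map_sum, LinearMap.sum_apply, Finset.sum_smul]
  refine Finset.sum_congr rfl fun c _ => ?_
  rw [map_smul, LinearMap.smul_apply, hw c, smul_smul]

/-- `v` is a highest weight vector of weight `μ`. -/
def IsHWVector (P : Set (Wt m n)) (μ : Wt m n) (v : V) : Prop :=
  v ≠ 0 ∧ v ∈ M.wtSpace μ ∧ ∀ α ∈ P, ∀ x ∈ rootSpace α, M.act x v = 0

theorem grade_sup : M.grade 0 ⊔ M.grade 1 = ⊤ := by
  rw [eq_top_iff, ← M.isInternal.submodule_iSup_eq_top]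
  refine iSup_le fun q => ?_
  rcases zmod2_cases q with rfl | rfl
  · exact le_sup_left
  · exact le_sup_right

theorem grade_disjoint : Disjoint (M.grade 0) (M.grade 1) :=
  M.isInternal.submodule_iSupIndep.pairwiseDisjoint (by decide : (0 : ZMod 2) ≠ 1)

theorem grade_add_eq_zero {p : ZMod 2} {v w : V} (hv : v ∈ M.grade p) (hw : w ∈ M.grade (p + 1))
    (h : v + w = 0) : v = 0 ∧ w = 0 := by
  have hd : Disjoint (M.grade p) (M.grade (p + 1)) := by
    rcases zmod2_cases p with rfl | rfl
    · rw [zero_add]; exact M.grade_disjoint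
    · rw [CharTwo.add_self_eq_zero]; exact M.grade_disjoint.symm
  have h1 : v = -w := eq_neg_of_add_eq_zero_left h
  have h2 : v = 0 := Submodule.disjoint_def.1 hd v hv (h1 ▸ neg_mem hw)
  exact ⟨h2, by rw [h2, zero_add] at h; exact h⟩

theorem act_grade_of_rootSpace {α : Wt m n} {x : osp m n} (hx : x ∈ rootSpace α) {q : ZMod 2}
    {v : V} (hv : v ∈ M.grade q) : M.act x v ∈ M.grade (par α + q) :=
  M.act_grade _ _ _ (rootSpace_mem_ospPart hx) _ hv

/-- A highest weight vector may be chosen homogeneous. -/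
theorem exists_homogeneous {P : Set (Wt m n)} {μ : Wt m n} {v : V} (hv : M.IsHWVector P μ v) :
    ∃ q, ∃ w ∈ M.grade q, M.IsHWVector P μ w := by
  obtain ⟨hv0, hvμ, hvP⟩ := hv
  have hv' : v ∈ M.grade 0 ⊔ M.grade 1 := by rw [M.grade_sup]; trivial
  obtain ⟨v0, h0, v1, h1, rfl⟩ := Submodule.mem_sup.1 hv'
  have hw : v0 ∈ M.wtSpace μ ∧ v1 ∈ M.wtSpace μ := by
    have key : ∀ a, M.act (cartan a) v0 - ((μ a : ℤ) : ℂ) • v0 = 0 ∧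
        M.act (cartan a) v1 - ((μ a : ℤ) : ℂ) • v1 = 0 := by
      intro a
      have ha := hvμ a
      have g0 := M.act_grade_of_rootSpace (cartan_mem_rootSpace a) h0
      have g1 := M.act_grade_of_rootSpace (cartan_mem_rootSpace a) h1
      rw [map_zero, zero_add] at g0 g1
      refine M.grade_add_eq_zero (p := 0) (sub_mem g0 (Submodule.smul_mem _ _ h0))
        (by rw [zero_add]; exact sub_mem g1 (Submodule.smul_mem _ _ h1)) ?_
      rw [map_add, smul_add] at ha
      rw [← sub_eq_zero] at ha
      rw [← ha]; abel
    exact ⟨fun a => sub_eq_zero.1 (key a).1, fun a => sub_eq_zero.1 (key a).2⟩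
  have hP : ∀ α ∈ P, ∀ x ∈ rootSpace α, M.act x v0 = 0 ∧ M.act x v1 = 0 := by
    intro α hα x hx
    have h := hvP α hα x hx
    rw [map_add] at h
    have g0 := M.act_grade_of_rootSpace hx h0
    have g1 := M.act_grade_of_rootSpace hx h1
    rw [add_zero] at g0
    exact M.grade_add_eq_zero g0 g1 h
  by_cases hz : v0 = 0
  · refine ⟨1, v1, h1, ?_, hw.2, fun α hα x hx => (hP α hα x hx).2⟩
    rintro rfl
    exact hv0 (by rw [hz, add_zero])
  · exact ⟨0, v0, h0, hz, hw.1, fun α hα x hx => (hP α hα x hx).1⟩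

/-! ### Uniqueness of the highest weight -/

/-- The subspace generated from `v` by negative root vectors. -/
noncomputable def lowering (f : Wt m n →+ ℝ) (v : V) : Submodule ℂ V :=
  sInf {U | v ∈ U ∧ ∀ α, f α < 0 → ∀ x ∈ rootSpace α, ∀ u ∈ U, M.act x u ∈ U}

theorem lowering_le {f : Wt m n →+ ℝ} {v : V} {U : Submodule ℂ V} (h1 : v ∈ U)
    (h2 : ∀ α, f α < 0 → ∀ x ∈ rootSpace α, ∀ u ∈ U, M.act x u ∈ U) : M.lowering f v ≤ U :=
  sInf_le ⟨h1, h2⟩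

theorem mem_lowering_self (f : Wt m n →+ ℝ) (v : V) : v ∈ M.lowering f v := by
  rw [lowering, Submodule.mem_sInf]
  exact fun U hU => hU.1

theorem act_mem_lowering {f : Wt m n →+ ℝ} {v : V} {α : Wt m n} (hα : f α < 0) {x : osp m n}
    (hx : x ∈ rootSpace α) {u : V} (hu : u ∈ M.lowering f v) : M.act x u ∈ M.lowering f v := by
  rw [lowering, Submodule.mem_sInf] at hu ⊢
  exact fun U hU => hU.2 α hα x hx u (hu U hU)

/-- An element of the algebra preserves a subspace if all root vectors and Cartan elements do. -/
theorem act_mem_of_rootSpace {W : Submodule ℂ V} {w : V}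
    (h : ∀ α, ∀ x ∈ rootSpace (m := m) (n := n) α, M.act x w ∈ W) (x : osp m n) :
    M.act x w ∈ W := by
  have hx : x ∈ ⨆ α : Wt m n, rootSpace α := by rw [iSup_rootSpace]; trivial
  have : (⨆ α : Wt m n, rootSpace α) ≤ W.comap (M.act.flip w) :=
    iSup_le fun α x hx => h α x hx
  exact this hx

/-- A weak form of the triangular decomposition: `v` is an eigenvector of the Cartan part and is
killed by the positive part, and commuting any element past a negative root vector gives only a
bracket and a reordered term. -/
theorem lowering_invariant {f : Wt m n →+ ℝ} (hf : ∀ α ∈ roots m n, f α ≠ 0) {μ : Wt m n} {v : V}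
    (hv : M.IsHWVector (posSys f) μ v) (x : osp m n) {w : V} (hw : w ∈ M.lowering f v) :
    M.act x w ∈ M.lowering f v := by
  -- The induction hypothesis must cover all elements of the algebra at once, since the bracket of
  -- `x` with a negative root vector may be any root vector.
  let U : Submodule ℂ V :=
    { carrier := {w | w ∈ M.lowering f v ∧ ∀ x, M.act x w ∈ M.lowering f v}
      add_mem' := fun ha hb => ⟨add_mem ha.1 hb.1, fun x => by
        rw [map_add]; exact add_mem (ha.2 x) (hb.2 x)⟩
      zero_mem' := ⟨zero_mem _, fun x => by rw [map_zero]; exact zero_mem _⟩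
      smul_mem' := fun c w hw => ⟨Submodule.smul_mem _ c hw.1, fun x => by
        rw [map_smul]; exact Submodule.smul_mem _ c (hw.2 x)⟩ }
  have : M.lowering f v ≤ U := by
    refine M.lowering_le ⟨M.mem_lowering_self f v, M.act_mem_of_rootSpace fun α x hx => ?_⟩ ?_
    · rcases lt_trichotomy (f α) 0 with h | h | h
      · exact M.act_mem_lowering h hx (M.mem_lowering_self f v)
      · by_cases h0 : α = 0
        · subst h0
          rw [M.act_zero_weight hx hv.2.1]
          exact Submodule.smul_mem _ _ (M.mem_lowering_self f v)
        · rw [rootSpace_eq_zero h0 (fun hr => hf α hr h) hx]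
          simp
      · by_cases hr : α ∈ roots m n
        · rw [hv.2.2 α ⟨hr, h⟩ x hx]; exact zero_mem _
        · rw [rootSpace_eq_zero (by rintro rfl; simp at h) hr hx]
          simp
    · intro β hβ y hy u hu
      refine ⟨M.act_mem_lowering hβ hy hu.1, M.act_mem_of_rootSpace fun α x hx => ?_⟩
      obtain ⟨z, -, -, h⟩ := M.act_comm hx hy
      rw [h]
      exact add_mem (hu.2 z) (Submodule.smul_mem _ _ (M.act_mem_lowering hβ hy (hu.2 x)))
  exact (this hw).2 x

theorem lowering_graded {f : Wt m n →+ ℝ} {v : V} {q : ZMod 2} (hv : v ∈ M.grade q) :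
    M.lowering f v = ⨆ p, M.lowering f v ⊓ M.grade p := by
  refine le_antisymm (M.lowering_le ?_ fun α hα x hx u hu => ?_) (iSup_le fun _ => inf_le_left)
  · exact Submodule.mem_iSup_of_mem q ⟨M.mem_lowering_self f v, hv⟩
  · have : (⨆ p, M.lowering f v ⊓ M.grade p) ≤
        (⨆ p, M.lowering f v ⊓ M.grade p).comap (M.act x) :=
      iSup_le fun p w hw => Submodule.mem_iSup_of_mem (par α + p)
        ⟨M.act_mem_lowering hα hx hw.1, M.act_grade_of_rootSpace hx hw.2⟩
    exact this hu

theorem lowering_eq_top (hM : M.IsIrreducible) {f : Wt m n →+ ℝ}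
    (hf : ∀ α ∈ roots m n, f α ≠ 0) {μ : Wt m n} {v : V}
    (hv : M.IsHWVector (posSys f) μ v) {q : ZMod 2} (hq : v ∈ M.grade q) :
    M.lowering f v = ⊤ := by
  refine (hM.2 _ (M.lowering_graded hq) fun x w hw => M.lowering_invariant hf hv x hw).resolve_left
    fun h => hv.1 ?_
  have := M.mem_lowering_self f v
  rwa [h, Submodule.mem_bot] at this

/-- The Cartan element that acts on the weight space of weight `ν` by `f ν`. -/
noncomputable def heightOp (f : Wt m n →+ ℝ) : Module.End ℂ V :=
  ∑ a, ((f (Pi.single a 1) : ℝ) : ℂ) • M.act (cartan a)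

/-- Weight spaces are compared through the single operator `heightOp f`, whose eigenspaces are
independent. -/
theorem wtSpace_le_eigenspace (f : Wt m n →+ ℝ) (ν : Wt m n) :
    M.wtSpace ν ≤ (M.heightOp f).eigenspace ((f ν : ℝ) : ℂ) := by
  intro w hw
  rw [Module.End.mem_eigenspace_iff]
  rw [heightOp, LinearMap.sum_apply, map_eq_sum_single]
  push_cast
  rw [Finset.sum_smul]
  refine Finset.sum_congr rfl fun a _ => ?_
  rw [LinearMap.smul_apply, hw a, smul_smul, mul_comm]

/-- Every negative root vector strictly lowers the value of `f`, so apart from multiples of `v` only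
weights below `μ` are reached. -/
theorem lowering_le_sup {f : Wt m n →+ ℝ} {μ : Wt m n} {v : V} (hv : v ∈ M.wtSpace μ) :
    M.lowering f v ≤ (ℂ ∙ v) ⊔ ⨆ ν : {ν : Wt m n // f ν < f μ}, M.wtSpace ν.1 := by
  refine M.lowering_le (Submodule.mem_sup_left (Submodule.mem_span_singleton_self v)) ?_
  intro α hα x hx
  suffices h : ((ℂ ∙ v) ⊔ ⨆ ν : {ν : Wt m n // f ν < f μ}, M.wtSpace ν.1) ≤
      ((ℂ ∙ v) ⊔ ⨆ ν : {ν : Wt m n // f ν < f μ}, M.wtSpace ν.1).comap (M.act x) from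
    fun u hu => h hu
  have key : ∀ ν : Wt m n, f ν ≤ f μ → ∀ w ∈ M.wtSpace ν, M.act x w ∈
      (ℂ ∙ v) ⊔ ⨆ ν : {ν : Wt m n // f ν < f μ}, M.wtSpace ν.1 := fun ν hν w hw =>
    Submodule.mem_sup_right (Submodule.mem_iSup_of_mem
      (⟨α + ν, by rw [map_add]; linarith⟩ : {ν : Wt m n // f ν < f μ}) (M.act_mem_wtSpace hx hw))
  refine sup_le ?_ (iSup_le fun ν w hw => key ν.1 ν.2.le w hw)
  rw [Submodule.span_singleton_le_iff_mem]
  exact key μ le_rfl v hv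

/-- The highest weight of an irreducible module is unique. -/
theorem hwVector_unique (hM : M.IsIrreducible) {f : Wt m n →+ ℝ}
    (hf : ∀ α ∈ roots m n, f α ≠ 0) {μ μ' : Wt m n} {v v' : V}
    (hv : M.IsHWVector (posSys f) μ v) (hv' : M.IsHWVector (posSys f) μ' v') : μ = μ' := by
  wlog hle : f μ ≤ f μ' generalizing μ μ' v v'
  · exact (this hv' hv (le_of_not_ge hle)).symm
  -- Irreducibility excludes only graded submodules, so the generating vector has to be homogeneous.
  obtain ⟨q, w, hq, hw⟩ := M.exists_homogeneous hv
  have htop : v' ∈ (ℂ ∙ w) ⊔ ⨆ ν : {ν : Wt m n // f ν < f μ}, M.wtSpace ν.1 := by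
    apply M.lowering_le_sup hw.2.1
    rw [M.lowering_eq_top hM hf hw hq]
    trivial
  obtain ⟨u, hu, t, ht, hut⟩ := Submodule.mem_sup.1 htop
  have hind := Module.End.eigenspaces_iSupIndep (M.heightOp f)
  have hdis := hind ((f μ' : ℝ) : ℂ)
  have e' := M.wtSpace_le_eigenspace f μ' hv'.2.1
  have hne : ∀ r : ℝ, r < f μ' → (r : ℂ) ≠ ((f μ' : ℝ) : ℂ) := fun r hr h =>
    hr.ne (Complex.ofReal_injective h)
  have hsub : (⨆ ν : {ν : Wt m n // f ν < f μ}, M.wtSpace ν.1) ≤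
      ⨆ j, ⨆ (_ : j ≠ ((f μ' : ℝ) : ℂ)), (M.heightOp f).eigenspace j :=
    iSup_le fun ν => (M.wtSpace_le_eigenspace f ν.1).trans
      (le_iSup₂_of_le ((f ν.1 : ℝ) : ℂ) (hne _ (ν.2.trans_le hle)) le_rfl)
  have huw := M.wtSpace_le_eigenspace f μ hw.2.1
  have huμ : u ∈ M.wtSpace μ :=
    (Submodule.span_singleton_le_iff_mem _ _).2 hw.2.1 hu
  have hu' := M.wtSpace_le_eigenspace f μ huμ
  -- If the values of `f` differ, `v'` lies in a sum of eigenspaces for other eigenvalues, which is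
  -- absurd. If they agree, the part `t` of lower value vanishes and `v'` is a multiple of `w`.
  rcases hle.lt_or_eq with hlt | heq
  · exfalso
    refine hv'.1 (Submodule.disjoint_def.1 hdis v' e' ?_)
    rw [← hut]
    exact add_mem (le_iSup₂_of_le (f := fun j (_ : j ≠ ((f μ' : ℝ) : ℂ)) =>
      (M.heightOp f).eigenspace j) ((f μ : ℝ) : ℂ) (hne _ hlt) le_rfl hu') (hsub ht)
  · rw [heq] at hu'
    have ht0 : t = 0 := by
      refine Submodule.disjoint_def.1 hdis t ?_ (hsub ht)
      have : t = v' - u := by rw [← hut]; abel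
      rw [this]
      exact sub_mem e' hu'
    rw [ht0, add_zero] at hut
    funext a
    have h1 := hv'.2.1 a
    rw [← hut, huμ a] at h1
    have hu0 : u ≠ 0 := hut ▸ hv'.1
    exact_mod_cast smul_left_injective ℂ hu0 h1

/-! ### Odd and even reflections -/

/-- The effect of passing from a positive system to an adjacent one, abstractly: `P'` arises from
the positive system of `f` by replacing the simple root `α` by `-α`. -/
structure Adjacent (f : Wt m n →+ ℝ) (P' : Set (Wt m n)) (α : Wt m n) : Prop where
  mem : α ∈ posSys f
  simple : ∀ β ∈ posSys f, β - α ∈ roots m n → β - α ∈ posSys f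
  of_mem : ∀ β ∈ P', β = -α ∨ (β ∈ posSys f ∧ β ≠ α)

section Reflection

variable {M} {f : Wt m n →+ ℝ} {P' : Set (Wt m n)} {α : Wt m n} {y : osp m n}

/-- The bracket of the root vectors for β and -α has weight β - α. This is either not a root, or a
positive root, again different from α. -/
theorem act_lower_eq_zero (hA : Adjacent f P' α) (hy : y ∈ rootSpace (-α)) {w : V}
    (hw : ∀ β ∈ posSys f, β ≠ α → ∀ x ∈ rootSpace β, M.act x w = 0) :
    ∀ β ∈ posSys f, β ≠ α → ∀ x ∈ rootSpace β, M.act x (M.act y w) = 0 := by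
  intro β hβ hne x hx
  obtain ⟨z, hz, -, h⟩ := M.act_comm hx hy
  rw [h, hw β hβ hne x hx, map_zero, smul_zero, add_zero]
  rw [← sub_eq_add_neg] at hz
  by_cases hr : β - α ∈ roots m n
  · refine hw _ (hA.simple β hβ hr) (fun h2 => ?_) z hz
    rw [sub_eq_iff_eq_add] at h2
    exact two_smul_notMem_roots hA.mem.1 (h2 ▸ hβ.1)
  · rw [rootSpace_eq_zero (sub_ne_zero.2 hne) hr hz]
    simp

variable {e : osp m n} {χ : Wt m n →+ ℤ}

/-- Odd reflections. -/
theorem odd_reflection (hM : M.IsIrreducible) (hf : ∀ α ∈ roots m n, f α ≠ 0)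
    (hA : Adjacent f P' α) (hodd : par α = 1)
    (hy : y ∈ rootSpace (-α)) (he : e ∈ rootSpace α)
    (hspan : ∀ x ∈ rootSpace α, ∃ c : ℂ, x = c • e)
    (hspan' : ∀ x ∈ rootSpace (-α), ∃ c : ℂ, x = c • y)
    (hχ : ∀ ν, ∀ w ∈ M.wtSpace ν,
      M.act e (M.act y w) = ((χ ν : ℤ) : ℂ) • w + sgn (par α) • M.act y (M.act e w))
    {μ : Wt m n} (hv : M.HasHighestWeight (posSys f) μ) :
    M.HasHighestWeight P' (if χ μ = 0 then μ else μ - α) := by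
  obtain ⟨v, hv⟩ := hv
  have hv' : M.IsHWVector (posSys f) μ v := hv
  have hα0 : α ≠ 0 := hA.mem.1.1
  have h0 := act_lower_eq_zero hA hy (fun β hβ _ x hx => hv'.2.2 β hβ x hx)
  have hev : M.act e v = 0 := hv'.2.2 α hA.mem e he
  have hey : M.act e (M.act y v) = ((χ μ : ℤ) : ℂ) • v := by
    rw [hχ μ v hv'.2.1, hev, map_zero, smul_zero, add_zero]
  have hwt : M.act y v ∈ M.wtSpace (μ - α) := by
    have := M.act_mem_wtSpace hy hv'.2.1
    rwa [neg_add_eq_sub] at this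
  split_ifs with hc
  -- Otherwise `y v` would be a highest weight vector of weight μ - α for the old positive system.
  · have hyv : M.act y v = 0 := by
      by_contra hne
      have : M.IsHWVector (posSys f) (μ - α) (M.act y v) := by
        refine ⟨hne, hwt, fun β hβ x hx => ?_⟩
        by_cases hβα : β = α
        · subst hβα
          obtain ⟨c, rfl⟩ := hspan x hx
          rw [map_smul, LinearMap.smul_apply, hey, hc]; simp
        · exact h0 β hβ hβα x hx
      have h3 := M.hwVector_unique hM hf hv' this
      exact hα0 (by rw [eq_comm, sub_eq_self] at h3; exact h3)
    refine ⟨v, hv'.1, hv'.2.1, fun β hβ x hx => ?_⟩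
    rcases hA.of_mem β hβ with rfl | ⟨h1, -⟩
    · obtain ⟨c, rfl⟩ := hspan' x hx
      rw [map_smul, LinearMap.smul_apply, hyv, smul_zero]
    · exact hv'.2.2 β h1 x hx
  · refine ⟨M.act y v, fun hz => ?_, hwt, fun β hβ x hx => ?_⟩
    · rw [hz, map_zero] at hey
      rcases smul_eq_zero.1 hey.symm with h | h
      · exact hc (by exact_mod_cast h)
      · exact hv'.1 h
    · rcases hA.of_mem β hβ with rfl | ⟨h1, h2⟩
      · obtain ⟨c, rfl⟩ := hspan' x hx
        rw [map_smul, LinearMap.smul_apply]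
        -- For odd `y` the bracket of `y` with itself is twice its square; it has weight -2α, which
        -- is not a root, so the square acts by zero.
        obtain ⟨z, hz, -, h⟩ := M.act_comm hy hy
        have hz0 : z = 0 := by
          refine rootSpace_eq_zero (fun h3 => hα0 ?_) (fun h3 => ?_) hz
          · funext a
            have := congrFun h3 a
            simp only [Pi.add_apply, Pi.neg_apply, Pi.zero_apply] at this ⊢
            omega
          · exact two_smul_notMem_roots (neg_mem_roots hA.mem.1) h3
        have h1 := h v
        rw [hz0, par_neg, hodd] at h1
        simp only [sgn, map_zero, LinearMap.zero_apply, mul_one, one_ne_zero, if_false, zero_add,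
          neg_smul, one_smul] at h1
        have h2 : (2 : ℂ) • M.act y (M.act y v) = 0 := by
          rw [two_smul]; exact add_eq_zero_iff_eq_neg.2 h1
        rw [(smul_eq_zero.1 h2).resolve_left two_ne_zero, smul_zero]
      · exact h0 β h1 h2 x hx

/-- Even reflections. -/
theorem even_reflection (hM : M.IsIrreducible) (hf : ∀ α ∈ roots m n, f α ≠ 0)
    (hA : Adjacent f P' α) (heven : par α = 0) (hχα : χ α = 2)
    (hy : y ∈ rootSpace (-α)) (he : e ∈ rootSpace α)
    (hspan : ∀ x ∈ rootSpace α, ∃ c : ℂ, x = c • e)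
    (hspan' : ∀ x ∈ rootSpace (-α), ∃ c : ℂ, x = c • y)
    (hχ : ∀ ν, ∀ w ∈ M.wtSpace ν,
      M.act e (M.act y w) = ((χ ν : ℤ) : ℂ) • w + sgn (par α) • M.act y (M.act e w))
    {μ : Wt m n} {k : ℕ} (hk : χ μ = k) (hv : M.HasHighestWeight (posSys f) μ) :
    M.HasHighestWeight P' (μ - (k : ℤ) • α) := by
  obtain ⟨v, hv⟩ := hv
  have hv' : M.IsHWVector (posSys f) μ v := hv
  have hα0 : α ≠ 0 := hA.mem.1.1
  have hev : M.act e v = 0 := hv'.2.2 α hA.mem e he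
  set Y := M.act y with hY
  have hpow : ∀ j : ℕ, (Y ^ (j + 1)) v = Y ((Y ^ j) v) := fun j => by
    rw [pow_succ', Module.End.mul_apply]
  have hwt : ∀ j : ℕ, (Y ^ j) v ∈ M.wtSpace (μ - (j : ℤ) • α) := by
    intro j
    induction j with
    | zero => simpa using hv'.2.1
    | succ j ih =>
      have := M.act_mem_wtSpace hy ih
      rw [hpow]
      convert this using 1
      push_cast
      rw [add_smul, one_smul]
      abel_nf
  have h0 : ∀ j : ℕ, ∀ β ∈ posSys f, β ≠ α → ∀ x ∈ rootSpace β, M.act x ((Y ^ j) v) = 0 := by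
    intro j
    induction j with
    | zero => exact fun β hβ _ x hx => by simpa using hv'.2.2 β hβ x hx
    | succ j ih =>
      rw [hpow]
      exact act_lower_eq_zero hA hy ih
  -- The sl₂ formula. Its coefficient vanishes at j = k, which kills the vector after `k + 1` steps,
  -- and is non-zero for j < k, which keeps the earlier ones alive.
  have hstep : ∀ j : ℕ, M.act e ((Y ^ (j + 1)) v) =
      (((j + 1 : ℕ) : ℂ) * ((k : ℂ) - j)) • (Y ^ j) v := by
    intro j
    induction j with
    | zero =>
      rw [hpow, hχ (μ - ((0 : ℕ) : ℤ) • α) _ (hwt 0)]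
      simp [hev, hk]
    | succ j ih =>
      rw [hpow, hχ _ _ (hwt (j + 1)), ih, map_smul, ← hpow, heven, map_sub, map_zsmul, hk, hχα,
        smul_smul, ← add_smul]
      congr 1
      simp [sgn]
      ring
  have hlast : (Y ^ (k + 1)) v = 0 := by
    by_contra hne
    have : M.IsHWVector (posSys f) (μ - ((k + 1 : ℕ) : ℤ) • α) ((Y ^ (k + 1)) v) := by
      refine ⟨hne, hwt _, fun β hβ x hx => ?_⟩
      by_cases hβα : β = α
      · subst hβα
        obtain ⟨c, rfl⟩ := hspan x hx
        rw [map_smul, LinearMap.smul_apply, hstep]; simp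
      · exact h0 _ β hβ hβα x hx
    have h3 := M.hwVector_unique hM hf hv' this
    rw [eq_comm, sub_eq_self, smul_eq_zero] at h3
    rcases h3 with h3 | h3
    · omega
    · exact hα0 h3
  have hne : ∀ j : ℕ, j ≤ k → (Y ^ j) v ≠ 0 := by
    intro j
    induction j with
    | zero => exact fun _ => by simpa using hv'.1
    | succ j ih =>
      intro hj hz
      have := hstep j
      rw [hz, map_zero, eq_comm, smul_eq_zero] at this
      rcases this with h | h
      · rcases mul_eq_zero.1 h with h | h
        · exact Nat.succ_ne_zero j (by exact_mod_cast h)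
        · rw [sub_eq_zero] at h
          have : k = j := by exact_mod_cast h
          omega
      · exact ih (by omega) h
  refine ⟨(Y ^ k) v, hne k le_rfl, hwt k, fun β hβ x hx => ?_⟩
  rcases hA.of_mem β hβ with rfl | ⟨h1, h2⟩
  · obtain ⟨c, rfl⟩ := hspan' x hx
    rw [map_smul, LinearMap.smul_apply, ← hY, ← hpow, hlast, smul_zero]
  · exact h0 k β h1 h2 x hx

end Reflection

/-! ### Brackets of opposite root vectors -/

/-- The coefficient of a weight at a signed label. -/
def coeff (a : Idx m n) : Wt m n →+ ℤ where
  toFun ν := (a.2 : ℤ) * ν a.1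
  map_zero' := by simp
  map_add' := by intro x y; simp [mul_add]

theorem coeff_apply (a : Idx m n) (ν : Wt m n) : coeff a ν = (a.2 : ℤ) * ν a.1 := rfl

theorem sum_diag_eq (g : Idx m n → ℂ) (a : Idx m n) (ν : Wt m n) (s : ℂ)
    (h : ∀ c, c ≠ a.1 → g (c, 1) = 0)
    (h1 : g (a.1, 1) = s * ((a.2 : ℤ) : ℂ)) :
    ∑ c : Lab m n, g (c, 1) * ((ν c : ℤ) : ℂ) = s * ((coeff a ν : ℤ) : ℂ) := by
  rw [Finset.sum_eq_single a.1]
  · rw [h1, coeff_apply]; push_cast; ring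
  · intro c _ hc
    rw [h c hc, zero_mul]
  · simp

/-- A diagonal entry of a weight zero element determines the opposite one. -/
theorem diag_plus {z : osp m n} (hz : z ∈ rootSpace 0) (a : Idx m n) :
    z.1 (a.1, 1) (a.1, 1) = ((a.2 : ℤ) : ℂ) * z.1 a a := by
  rcases Int.units_eq_one_or a.2 with h | h
  · have : a = (a.1, 1) := Prod.ext rfl h
    rw [← this, h]; simp
  · have h2 : (a.1, 1) = bar a := Prod.ext rfl (by rw [bar_snd, h, neg_neg])
    rw [h2, entry_bar hz, h, coef, mul_assoc, gsign_mul_self, CharTwo.add_self_eq_zero]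
    simp [sgn]

theorem mul_diag_eq_zero {α : Wt m n} {x y : osp m n} {i : Idx m n} (hx : x ∈ rootSpace α)
    (h : ∀ c, wt i - wt c ≠ α) : (x.1 * y.1) i i = 0 := by
  rw [Matrix.mul_apply]
  refine Finset.sum_eq_zero fun c _ => ?_
  by_cases h0 : x.1 i c = 0
  · rw [h0, zero_mul]
  · exact absurd (mem_rootSpace_iff.1 hx i c h0) (h c)

/-- Row `a` of `x` has its only non-zero entry in column `b`, because distinct basis vectors have
distinct weights. -/
theorem mul_diag_eq {a b : Idx m n} {x y : osp m n} (hx : x ∈ rootSpace (wt a - wt b))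
    (hx1 : x.1 a b = 1) (hy1 : y.1 b a = 1) : (x.1 * y.1) a a = 1 := by
  rw [Matrix.mul_apply, Finset.sum_eq_single b]
  · rw [hx1, hy1, one_mul]
  · intro c _ hc
    by_cases h0 : x.1 a c = 0
    · rw [h0, zero_mul]
    · exact absurd (wt_injective (sub_right_injective (mem_rootSpace_iff.1 hx a c h0))) hc
  · simp

/-- Short roots: the action of the bracket of opposite root vectors. -/
theorem bracket_short (M : OspModule m n V) {a b : Idx m n} (hab : a.1 ≠ b.1) {x y : osp m n}
    (hx : x ∈ rootSpace (wt a - wt b)) (hx1 : x.1 a b = 1)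
    (hy : y ∈ rootSpace (wt b - wt a)) (hy1 : y.1 b a = 1) {ν : Wt m n} {w : V}
    (hw : w ∈ M.wtSpace ν) :
    M.act x (M.act y w) = (((coeff a ν : ℤ) : ℂ) - sgn (par (wt a - wt b)) *
      ((coeff b ν : ℤ) : ℂ)) • w +
      sgn (par (wt a - wt b)) • M.act y (M.act x w) := by
  obtain ⟨z, hz, hz1, h⟩ := M.act_comm hx hy
  have hpb : par (wt b - wt a) = par (wt a - wt b) := by rw [← par_neg, neg_sub]
  have hpp : par (wt a - wt b) * par (wt a - wt b) = par (wt a - wt b) := by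
    rcases zmod2_cases (par (wt a - wt b)) with h | h <;> rw [h] <;> rfl
  rw [hpb, hpp] at h
  rw [hpb] at hz1
  have hz' : z ∈ rootSpace 0 := by
    rwa [sub_add_sub_cancel, sub_self] at hz
  rw [h, M.act_zero_weight hz' hw]
  congr 2
  have hzd : ∀ i, z.1 i i = (x.1 * y.1) i i - sgn (par (wt a - wt b)) * (y.1 * x.1) i i := by
    intro i
    rw [hz1, sbracket, hpp, Matrix.sub_apply, Matrix.smul_apply, smul_eq_mul]
  -- A root vector for `wt a - wt b` has non-zero rows only at `a` and `bar b`; this leaves one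
  -- product term for each diagonal entry needed below.
  have ne1 : ∀ {a b i c : Idx m n}, a.1 ≠ b.1 → i ≠ a → i ≠ bar b → wt i - wt c ≠ wt a - wt b := by
    intro a b i c hab h1 h2 h3
    rcases wt_sub_eq_iff hab h3 with ⟨h4, -⟩ | ⟨h4, -⟩
    · exact h1 h4
    · exact h2 h4
  have nb : a ≠ b := fun h => hab (congrArg Prod.fst h)
  have za : z.1 a a = 1 := by
    rw [hzd, mul_diag_eq hx hx1 hy1, mul_diag_eq_zero hy fun c => ne1 hab.symm nb (bar_ne a).symm]
    ring
  have zb : z.1 b b = -sgn (par (wt a - wt b)) := by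
    rw [hzd, mul_diag_eq hy hy1 hx1, mul_diag_eq_zero hx fun c => ne1 hab nb.symm (bar_ne b).symm]
    ring
  have zo : ∀ c, c ≠ a.1 → c ≠ b.1 → z.1 (c, 1) (c, 1) = 0 := by
    intro c h1 h2
    have g1 : ∀ d : Idx m n, d.1 = a.1 → ((c, 1) : Idx m n) ≠ d := fun d hd h =>
      h1 ((congrArg Prod.fst h).trans hd)
    have g2 : ∀ d : Idx m n, d.1 = b.1 → ((c, 1) : Idx m n) ≠ d := fun d hd h =>
      h2 ((congrArg Prod.fst h).trans hd)
    rw [hzd, mul_diag_eq_zero hx fun d => ne1 hab (g1 _ rfl) (g2 _ rfl),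
      mul_diag_eq_zero hy fun d => ne1 hab.symm (g2 _ rfl) (g1 _ rfl)]
    ring
  have ha := diag_plus hz' a
  have hb := diag_plus hz' b
  rw [za] at ha
  rw [zb] at hb
  rw [Fintype.sum_eq_add a.1 b.1 hab fun c hc => by rw [zo c hc.1 hc.2, zero_mul], ha, hb,
    coeff_apply, coeff_apply]
  push_cast
  ring

/-- Long roots: the action of the bracket of opposite root vectors. -/
theorem bracket_long (M : OspModule m n V) {a : Idx m n} {x y : osp m n}
    (hx : x ∈ rootSpace (wt a - wt (bar a))) (hx1 : x.1 a (bar a) = 1)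
    (hy : y ∈ rootSpace (wt (bar a) - wt a)) (hy1 : y.1 (bar a) a = 1) {ν : Wt m n} {w : V}
    (hw : w ∈ M.wtSpace ν) :
    M.act x (M.act y w) = ((coeff a ν : ℤ) : ℂ) • w + M.act y (M.act x w) := by
  obtain ⟨z, hz, hz1, h⟩ := M.act_comm hx hy
  have hp : par (wt a - wt (bar a)) = 0 := by
    rw [par_wt_sub, parity_bar]; exact CharTwo.add_self_eq_zero _
  have s0 : sgn 0 = 1 := if_pos rfl
  rw [hp, zero_mul, s0] at h
  simp only [one_smul] at h
  have hz' : z ∈ rootSpace 0 := by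
    rwa [sub_add_sub_cancel, sub_self] at hz
  rw [h, M.act_zero_weight hz' hw]
  congr 2
  have hzd : ∀ i, z.1 i i = (x.1 * y.1) i i - (y.1 * x.1) i i := by
    intro i
    rw [hz1, hp, sbracket, zero_mul, s0, one_smul, Matrix.sub_apply]
  have ne1 : ∀ {i c : Idx m n}, i ≠ a → wt i - wt c ≠ wt a - wt (bar a) :=
    fun h1 h3 => h1 (wt_sub_eq_long_iff h3).1
  have ne2 : ∀ {i c : Idx m n}, i ≠ bar a → wt i - wt c ≠ wt (bar a) - wt a := by
    intro i c h1 h3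
    exact h1 (wt_sub_eq_long_iff (a := bar a) (j := c) (by rwa [bar_bar])).1
  have za : z.1 a a = 1 := by
    rw [hzd, mul_diag_eq hx hx1 hy1, mul_diag_eq_zero hy fun c => ne2 (bar_ne a).symm]
    ring
  have zo : ∀ c, c ≠ a.1 → z.1 (c, 1) (c, 1) = 0 := by
    intro c h1
    rw [hzd, mul_diag_eq_zero hx fun d => ne1 fun h => h1 (congrArg Prod.fst h),
      mul_diag_eq_zero hy fun d => ne2 fun h => h1 (congrArg Prod.fst h)]
    ring
  have ha := diag_plus hz' a
  rw [za] at ha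
  rw [sum_diag_eq (fun i => z.1 i i) a ν 1 zo (by rw [ha]; ring), one_mul]

end OspModule

/-! ### Positive systems and their simple roots -/

/-- There are finitely many roots, so a counterexample with least value of `f` exists. It is not
simple, hence a sum of two positive roots of smaller value, which are not counterexamples. -/
theorem posSys_subset_closure (f : Wt m n →+ ℝ) :
    posSys f ⊆ AddSubmonoid.closure (simpleRoots (posSys f)) := by
  by_contra h
  rw [Set.not_subset] at h
  obtain ⟨β, hβ, hβ'⟩ := h
  have hfin : (posSys f \ AddSubmonoid.closure (simpleRoots (posSys f))).Finite :=
    roots_finite.subset fun α hα => hα.1.1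
  obtain ⟨α, ⟨hα, hα'⟩, hmin⟩ := Set.exists_min_image _ f hfin ⟨β, hβ, hβ'⟩
  refine hα' (AddSubmonoid.subset_closure ⟨hα, ?_⟩)
  rintro ⟨γ, hγ, δ, hδ, hs⟩
  have hmem : ∀ γ ∈ posSys f, f γ < f α → γ ∈ AddSubmonoid.closure (simpleRoots (posSys f)) := by
    intro γ hγ hlt
    by_contra h
    exact absurd (hmin γ ⟨hγ, h⟩) (not_le.2 hlt)
  refine hα' (hs ▸ add_mem (hmem γ hγ ?_) (hmem δ hδ ?_))
  · rw [hs, map_add]; linarith [hδ.2]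
  · rw [hs, map_add]; linarith [hγ.2]

/-- The functional is non-negative on sums of simple roots and vanishes on no root, so a positive
system can be recovered from its simple roots. -/
theorem closure_eq_posSys {f : Wt m n →+ ℝ} (hf : ∀ α ∈ roots m n, f α ≠ 0) {S : Set (Wt m n)}
    (hS : simpleRoots (posSys f) = S) :
    {α | α ∈ roots m n ∧ α ∈ AddSubmonoid.closure S} = posSys f := by
  subst hS
  ext α
  refine ⟨fun ⟨h1, h2⟩ => ⟨h1, lt_of_le_of_ne ?_ (hf α h1).symm⟩,
    fun h => ⟨h.1, posSys_subset_closure f h⟩⟩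
  have : AddSubmonoid.closure (simpleRoots (posSys f)) ≤
      (AddSubmonoid.nonneg ℝ).comap f :=
    (AddSubmonoid.closure_le).2 fun β hβ => hβ.1.2.le
  exact this h2

theorem posSys_eq_of_simpleRoots_eq {f g : Wt m n →+ ℝ} (hf : ∀ α ∈ roots m n, f α ≠ 0)
    (hg : ∀ α ∈ roots m n, g α ≠ 0) (h : simpleRoots (posSys f) = simpleRoots (posSys g)) :
    posSys f = posSys g := by
  rw [← closure_eq_posSys hf rfl, ← closure_eq_posSys hg rfl, h]

namespace SignedSeq

/-! ### The positive system of a signed sequence -/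

/-- The signed label in place `k`. -/
def idx (D : SignedSeq m n) (k : Fin (n + m)) : Idx m n := (D.lab k, D.sign k)

theorem wt_idx (D : SignedSeq m n) (k : Fin (n + m)) : wt (D.idx k) = D.entry k := rfl

/-- The functional with value `w k` on the entry in place `k`. -/
noncomputable def height (D : SignedSeq m n) (w : Fin (n + m) → ℝ) : Wt m n →+ ℝ where
  toFun α := ∑ k, w k * (((D.sign k : ℤ) * α (D.lab k) : ℤ) : ℝ)
  map_zero' := by simp
  map_add' := by
    intro x y
    rw [← Finset.sum_add_distrib]
    refine Finset.sum_congr rfl fun k _ => ?_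
    rw [Pi.add_apply]
    push_cast
    ring

theorem height_apply (D : SignedSeq m n) (w : Fin (n + m) → ℝ) (α : Wt m n) :
    D.height w α = ∑ k, w k * (((D.sign k : ℤ) * α (D.lab k) : ℤ) : ℝ) := rfl

theorem entry_apply_lab (D : SignedSeq m n) (k l : Fin (n + m)) :
    D.entry k (D.lab l) = if l = k then (D.sign k : ℤ) else 0 := by
  simp [entry, Pi.single_apply]

theorem sign_mul_self (D : SignedSeq m n) (k : Fin (n + m)) :
    (D.sign k : ℤ) * (D.sign k : ℤ) = 1 := by
  rcases Int.units_eq_one_or (D.sign k) with h | h <;> simp [h]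

@[simp] theorem height_entry (D : SignedSeq m n) (w : Fin (n + m) → ℝ) (k : Fin (n + m)) :
    D.height w (D.entry k) = w k := by
  rw [height_apply, Finset.sum_eq_single k]
  · rw [entry_apply_lab, if_pos rfl, sign_mul_self]; simp
  · intro l _ hl
    rw [entry_apply_lab, if_neg hl]; simp
  · simp

/-- The positive system attached to a signed sequence. -/
def pos (D : SignedSeq m n) : Set (Wt m n) :=
  {α | (∃ i j : Fin (n + m), i < j ∧ ∃ t : ℤˣ, α = D.entry i + (t : ℤ) • D.entry j) ∨
    ∃ i : Fin (n + m), (D.lab i).isLeft = true ∧ α = (2 : ℤ) • D.entry i}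

theorem wt_eq_smul_entry (D : SignedSeq m n) (a : Idx m n) :
    ∃ s : ℤˣ, wt a = (s : ℤ) • D.entry (D.lab.symm a.1) := by
  refine ⟨a.2 * D.sign (D.lab.symm a.1), ?_⟩
  rw [entry, Equiv.apply_symm_apply, ← Pi.single_smul, wt, smul_eq_mul]
  push_cast
  rw [mul_assoc, sign_mul_self, mul_one]

theorem smul_entry_eq_wt (D : SignedSeq m n) (s : ℤˣ) (k : Fin (n + m)) :
    (s : ℤ) • D.entry k = wt (D.lab k, s * D.sign k) := by
  rw [entry, ← Pi.single_smul, wt, smul_eq_mul]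
  push_cast
  rfl

/-- The roots in terms of the entries of a sequence. -/
theorem mem_roots_iff_entry (D : SignedSeq m n) {α : Wt m n} : α ∈ roots m n ↔
    (∃ i j : Fin (n + m), i < j ∧ ∃ s t : ℤˣ,
      α = (s : ℤ) • D.entry i + (t : ℤ) • D.entry j) ∨
    ∃ i : Fin (n + m), (D.lab i).isLeft = true ∧ ∃ s : ℤˣ, α = (2 * s : ℤ) • D.entry i := by
  rw [mem_roots_iff]
  constructor
  · rintro ⟨a, b, rfl, hab | ⟨rfl, ha⟩⟩
    · obtain ⟨s, hs⟩ := D.wt_eq_smul_entry a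
      obtain ⟨t, ht⟩ := D.wt_eq_smul_entry b
      left
      rw [hs, ht]
      have hne : D.lab.symm a.1 ≠ D.lab.symm b.1 := fun h => hab (D.lab.symm.injective h)
      rcases lt_or_gt_of_ne hne with h | h
      · refine ⟨_, _, h, s, -t, ?_⟩
        rw [Units.val_neg, neg_smul, sub_eq_add_neg]
      · refine ⟨_, _, h, -t, s, ?_⟩
        rw [Units.val_neg, neg_smul]; abel
    · obtain ⟨s, hs⟩ := D.wt_eq_smul_entry a
      right
      refine ⟨D.lab.symm a.1, by simpa using ha, s, ?_⟩
      rw [wt_bar, hs, sub_neg_eq_add, ← add_smul, two_mul]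
  · rintro (⟨i, j, hij, s, t, rfl⟩ | ⟨i, hi, s, rfl⟩)
    · refine ⟨(D.lab i, s * D.sign i), (D.lab j, -t * D.sign j), ?_,
        Or.inl fun h => hij.ne (D.lab.injective h)⟩
      rw [← smul_entry_eq_wt, ← smul_entry_eq_wt, Units.val_neg, neg_smul, sub_neg_eq_add]
    · refine ⟨(D.lab i, s * D.sign i), bar (D.lab i, s * D.sign i), ?_, Or.inr ⟨rfl, hi⟩⟩
      rw [wt_bar, ← smul_entry_eq_wt, sub_neg_eq_add, ← add_smul, two_mul]

/-- Values on the entries that lead to the positive system of the sequence. -/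
def Dominant (D : SignedSeq m n) (w : Fin (n + m) → ℝ) : Prop :=
  (∀ i j, i < j → |w j| < w i) ∧ ∀ i, (D.lab i).isLeft = true → 0 < w i

/-- The value at the earlier entry exceeds the later one in absolute value, so the sign of the whole
is that of the leading term. -/
theorem height_pair_pos_iff {D : SignedSeq m n} {w : Fin (n + m) → ℝ} (hw : D.Dominant w)
    {i j : Fin (n + m)} (hij : i < j) (s t : ℤˣ) :
    D.height w ((s : ℤ) • D.entry i + (t : ℤ) • D.entry j) ≠ 0 ∧
      (0 < D.height w ((s : ℤ) • D.entry i + (t : ℤ) • D.entry j) ↔ s = 1) := by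
  have h := abs_lt.1 (hw.1 i j hij)
  have h1 : (-1 : ℤˣ) ≠ 1 := by decide
  rw [map_add, map_zsmul, map_zsmul, height_entry, height_entry]
  rcases Int.units_eq_one_or s with rfl | rfl <;> rcases Int.units_eq_one_or t with rfl | rfl <;>
    simp only [Units.val_one, Units.val_neg, one_smul, neg_smul, h1, iff_true, iff_false, not_lt]
  · exact ⟨by linarith, by linarith⟩
  · exact ⟨by linarith, by linarith⟩
  · exact ⟨by linarith, by linarith⟩
  · exact ⟨by linarith, by linarith⟩

theorem height_long_pos_iff {D : SignedSeq m n} {w : Fin (n + m) → ℝ} (hw : D.Dominant w)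
    {i : Fin (n + m)} (hi : (D.lab i).isLeft = true) (s : ℤˣ) :
    D.height w ((2 * s : ℤ) • D.entry i) ≠ 0 ∧
      (0 < D.height w ((2 * s : ℤ) • D.entry i) ↔ s = 1) := by
  have h := hw.2 i hi
  have h1 : (-1 : ℤˣ) ≠ 1 := by decide
  rw [map_zsmul, height_entry, zsmul_eq_mul]
  rcases Int.units_eq_one_or s with rfl | rfl <;> push_cast <;>
    simp only [h1, iff_true, iff_false, not_lt]
  · exact ⟨by linarith, by linarith⟩
  · exact ⟨by linarith, by linarith⟩

theorem Dominant.height_ne_zero {D : SignedSeq m n} {w : Fin (n + m) → ℝ} (hw : D.Dominant w) :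
    ∀ α ∈ roots m n, D.height w α ≠ 0 := by
  intro α hα
  rcases D.mem_roots_iff_entry.1 hα with ⟨i, j, hij, s, t, rfl⟩ | ⟨i, hi, s, rfl⟩
  · exact (height_pair_pos_iff hw hij s t).1
  · exact (height_long_pos_iff hw hi s).1

theorem Dominant.posSys_eq {D : SignedSeq m n} {w : Fin (n + m) → ℝ} (hw : D.Dominant w) :
    posSys (D.height w) = D.pos := by
  ext α
  constructor
  · rintro ⟨hα, h⟩
    rcases D.mem_roots_iff_entry.1 hα with ⟨i, j, hij, s, t, rfl⟩ | ⟨i, hi, s, rfl⟩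
    · rw [(height_pair_pos_iff hw hij s t).2.1 h]
      exact Or.inl ⟨i, j, hij, t, by simp⟩
    · rw [(height_long_pos_iff hw hi s).2.1 h]
      exact Or.inr ⟨i, hi, by simp⟩
  · rintro (⟨i, j, hij, t, rfl⟩ | ⟨i, hi, rfl⟩)
    · have := (height_pair_pos_iff hw hij 1 t).2.2 rfl
      rw [Units.val_one, one_smul] at this
      exact ⟨D.mem_roots_iff_entry.2 (Or.inl ⟨i, j, hij, 1, t, by simp⟩), this⟩
    · have := (height_long_pos_iff hw hi 1).2.2 rfl
      rw [Units.val_one, mul_one] at this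
      exact ⟨D.mem_roots_iff_entry.2 (Or.inr ⟨i, hi, 1, by simp⟩), this⟩

/-- Regular dominant values on the entries. -/
noncomputable def stdHeight (m n : ℕ) (k : Fin (n + m)) : ℝ := ((n + m : ℕ) : ℝ) - (k : ℕ)

theorem dominant_std (D : SignedSeq m n) : D.Dominant (stdHeight m n) := by
  have h : ∀ k : Fin (n + m), 0 < stdHeight m n k := fun k => by
    have : ((k : ℕ) : ℝ) < ((n + m : ℕ) : ℝ) := by exact_mod_cast k.2
    unfold stdHeight; linarith
  refine ⟨fun i j hij => ?_, fun i _ => h i⟩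
  rw [abs_of_pos (h j)]
  have : ((i : ℕ) : ℝ) < ((j : ℕ) : ℝ) := by exact_mod_cast hij
  unfold stdHeight; linarith

theorem stdHeight_succ {i j : Fin (n + m)} (h : i < j) : stdHeight m n j + 1 ≤ stdHeight m n i := by
  have : ((i : ℕ) : ℝ) + 1 ≤ ((j : ℕ) : ℝ) := by exact_mod_cast h
  unfold stdHeight; linarith

theorem one_le_stdHeight (i : Fin (n + m)) : 1 ≤ stdHeight m n i := by
  have : ((i : ℕ) : ℝ) + 1 ≤ ((n + m : ℕ) : ℝ) := by exact_mod_cast i.2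
  unfold stdHeight; linarith

theorem one_le_height {D : SignedSeq m n} {α : Wt m n} (hα : α ∈ D.pos) :
    1 ≤ D.height (stdHeight m n) α := by
  rcases hα with ⟨i, j, hij, t, rfl⟩ | ⟨i, hi, rfl⟩
  · rw [map_add, map_zsmul, height_entry, height_entry]
    have h1 := stdHeight_succ hij
    have h2 := one_le_stdHeight j
    rcases Int.units_eq_one_or t with rfl | rfl <;>
      simp only [Units.val_one, Units.val_neg, one_smul, neg_smul] <;> linarith
  · rw [map_zsmul, height_entry, zsmul_eq_mul]
    have := one_le_stdHeight i
    push_cast; linarith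

theorem neg_notMem_pos {D : SignedSeq m n} {α : Wt m n} (hα : α ∈ D.pos) : -α ∉ D.pos := by
  intro h
  have h1 := one_le_height hα
  have h2 := one_le_height h
  rw [map_neg] at h2
  linarith

theorem sub_mem_pos (D : SignedSeq m n) {i j : Fin (n + m)} (h : i < j) :
    D.entry i - D.entry j ∈ D.pos := Or.inl ⟨i, j, h, -1, by simp [sub_eq_add_neg]⟩

theorem add_mem_pos (D : SignedSeq m n) {i j : Fin (n + m)} (h : i < j) :
    D.entry i + D.entry j ∈ D.pos := Or.inl ⟨i, j, h, 1, by simp⟩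

theorem two_smul_mem_pos (D : SignedSeq m n) {i : Fin (n + m)} (h : (D.lab i).isLeft = true) :
    (2 : ℤ) • D.entry i ∈ D.pos := Or.inr ⟨i, h, rfl⟩

theorem simple_subset_pos (D : SignedSeq m n) : D.simple ⊆ D.pos := by
  rintro α ((⟨k, l, h, rfl⟩ | ⟨k, -, h, rfl⟩) | ⟨k, l, h, -, -, rfl⟩)
  · exact D.sub_mem_pos (Fin.lt_def.2 (by omega))
  · have := D.two_smul_mem_pos h
    rwa [two_smul, ← two_nsmul] at this
  · exact D.add_mem_pos (Fin.lt_def.2 (by omega))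

/-- Values on the entries that are minimal on the simple roots. -/
noncomputable def rhoHeight (D : SignedSeq m n) (k : Fin (n + m)) : ℝ :=
  2 * stdHeight m n k - (if ∃ l : Fin (n + m), (l : ℕ) + 1 = n + m ∧ (D.lab l).isLeft = true
    then 1 else 2)

/-- A sum of two positive roots has value at least 4, whereas simple roots have value 2; this shows
that the roots read off from the sequence are indecomposable. -/
theorem two_le_rhoHeight {D : SignedSeq m n} {α : Wt m n} (hα : α ∈ D.pos) :
    2 ≤ D.height D.rhoHeight α := by
  rcases hα with ⟨i, j, hij, t, rfl⟩ | ⟨i, hi, rfl⟩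
  · rw [map_add, map_zsmul, height_entry, height_entry]
    have h1 := stdHeight_succ hij
    have h2 := one_le_stdHeight j
    unfold rhoHeight
    rcases Int.units_eq_one_or t with rfl | rfl <;>
      simp only [Units.val_one, Units.val_neg, one_smul, neg_smul] <;> split_ifs <;> linarith
  · rw [map_zsmul, height_entry, zsmul_eq_mul]
    have h1 := one_le_stdHeight i
    unfold rhoHeight
    push_cast
    split_ifs with h
    · linarith
    · have h3 : (i : ℕ) + 1 ≠ n + m := fun h3 => h ⟨i, h3, hi⟩
      have h2 : ((i : ℕ) : ℝ) + 2 ≤ ((n + m : ℕ) : ℝ) := by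
        have : (i : ℕ) + 2 ≤ n + m := by have := i.2; omega
        exact_mod_cast this
      unfold stdHeight
      linarith

/-- Neighbouring values differ by 2, and the last value is 1 for a δ and 0 for an ε. Thus twice a
final δ, and the sum of the last two entries before a final ε, also get the value 2. -/
theorem rhoHeight_simple {D : SignedSeq m n} {α : Wt m n} (hα : α ∈ D.simple) :
    D.height D.rhoHeight α = 2 := by
  have succ : ∀ k l : Fin (n + m), (k : ℕ) + 1 = l → stdHeight m n k = stdHeight m n l + 1 := by
    intro k l h
    unfold stdHeight
    rw [← h]; push_cast; ring
  have last : ∀ k : Fin (n + m), (k : ℕ) + 1 = n + m → stdHeight m n k = 1 := by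
    intro k h
    have : ((k : ℕ) : ℝ) + 1 = ((n + m : ℕ) : ℝ) := by exact_mod_cast h
    unfold stdHeight
    linarith
  rcases hα with (⟨k, l, h, rfl⟩ | ⟨k, h, hk, rfl⟩) | ⟨k, l, h, h2, hl, rfl⟩
  · rw [map_sub, height_entry, height_entry, rhoHeight, rhoHeight, succ k l h]
    ring
  · rw [map_nsmul, height_entry, rhoHeight, if_pos ⟨k, h, hk⟩, last k h]
    norm_num
  · rw [map_add, height_entry, height_entry, rhoHeight, rhoHeight, if_neg, succ k l h, last l h2]
    · norm_num
    · rintro ⟨l', h3, h4⟩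
      have : l' = l := Fin.ext (by omega)
      subst this
      rw [← Sum.not_isLeft, h4] at hl
      exact absurd hl (by decide)

/-- A positive root that is not in the list splits by inserting an intermediate entry, the last
entry, or twice a final δ. Conversely, `rhoHeight` forbids splitting a listed root. -/
theorem simpleRoots_pos (D : SignedSeq m n) : simpleRoots D.pos = D.simple := by
  ext α
  constructor
  · rintro ⟨hα, hind⟩
    have hind' : ∀ β γ, β ∈ D.pos → γ ∈ D.pos → α = β + γ → False :=
      fun β γ hβ hγ h => hind ⟨β, hβ, γ, hγ, h⟩
    rcases hα with ⟨i, j, hij, t, rfl⟩ | ⟨i, hi, rfl⟩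
    · rcases Int.units_eq_one_or t with rfl | rfl
      · by_cases hj : (j : ℕ) + 1 = n + m
        · by_cases hl : (D.lab j).isLeft = true
          · exfalso
            refine hind' _ _ (D.sub_mem_pos hij) (D.two_smul_mem_pos hl) ?_
            rw [Units.val_one, one_smul, two_smul]; abel
          · by_cases hk : (i : ℕ) + 1 = j
            · refine Or.inr ⟨i, j, hk, hj, ?_, by simp⟩
              simpa using hl
            · exfalso
              have hij' := Fin.lt_def.1 hij
              have hk' : (i : ℕ) + 1 < n + m := by omega
              refine hind' _ _ (D.sub_mem_pos (i := i) (j := ⟨i + 1, hk'⟩)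
                (Fin.lt_def.2 (Nat.lt_succ_self _)))
                (D.add_mem_pos (i := ⟨i + 1, hk'⟩) (j := j) (Fin.lt_def.2 ?_)) ?_
              · change (i : ℕ) + 1 < j
                omega
              · rw [Units.val_one, one_smul]; abel
        · exfalso
          have hij' := Fin.lt_def.1 hij
          have hj' := j.2
          have hN : n + m - 1 < n + m := by omega
          refine hind' _ _ (D.sub_mem_pos (i := i) (j := ⟨n + m - 1, hN⟩) (Fin.lt_def.2 ?_))
            (D.add_mem_pos (i := j) (j := ⟨n + m - 1, hN⟩) (Fin.lt_def.2 ?_)) ?_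
          · change (i : ℕ) < n + m - 1
            omega
          · change (j : ℕ) < n + m - 1
            omega
          · rw [Units.val_one, one_smul]; abel
      · by_cases hk : (i : ℕ) + 1 = j
        · exact Or.inl (Or.inl ⟨i, j, hk, by simp [sub_eq_add_neg]⟩)
        · exfalso
          have hij' := Fin.lt_def.1 hij
          have hj' := j.2
          have hk' : (i : ℕ) + 1 < n + m := by omega
          refine hind' _ _ (D.sub_mem_pos (i := i) (j := ⟨i + 1, hk'⟩)
            (Fin.lt_def.2 (Nat.lt_succ_self _)))
            (D.sub_mem_pos (i := ⟨i + 1, hk'⟩) (j := j) (Fin.lt_def.2 ?_)) ?_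
          · change (i : ℕ) + 1 < j
            omega
          · rw [Units.val_neg, Units.val_one, neg_smul, one_smul]; abel
    · by_cases hk : (i : ℕ) + 1 = n + m
      · refine Or.inl (Or.inr ⟨i, hk, hi, ?_⟩)
        rw [two_smul, two_nsmul]
      · exfalso
        have hi' := i.2
        have hN : n + m - 1 < n + m := by omega
        have hlt : i < ⟨n + m - 1, hN⟩ := by
          rw [Fin.lt_def]
          change (i : ℕ) < n + m - 1
          omega
        refine hind' _ _ (D.sub_mem_pos hlt) (D.add_mem_pos hlt) ?_
        rw [two_smul]; abel
  · intro hα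
    refine ⟨D.simple_subset_pos hα, ?_⟩
    rintro ⟨β, hβ, γ, hγ, rfl⟩
    have h := rhoHeight_simple hα
    rw [map_add] at h
    linarith [two_le_rhoHeight hβ, two_le_rhoHeight hγ]

/-- A positive system is determined by the simple roots. -/
theorem eq_pos_of_simpleRoots {D : SignedSeq m n} {P : Set (Wt m n)} (hP : IsPositiveSystem P)
    (h : simpleRoots P = D.simple) : P = D.pos := by
  obtain ⟨f, hf, rfl⟩ := hP
  change simpleRoots (posSys f) = _ at h
  change posSys f = _
  rw [← D.dominant_std.posSys_eq]
  refine posSys_eq_of_simpleRoots_eq hf D.dominant_std.height_ne_zero ?_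
  rw [h, D.dominant_std.posSys_eq, simpleRoots_pos]

theorem standardPos_eq : standardPos m n = (standard m n).pos := by
  rw [← (dominant_std _).posSys_eq]
  refine closure_eq_posSys (dominant_std _).height_ne_zero ?_
  rw [(dominant_std _).posSys_eq, simpleRoots_pos]

/-- Every positive system comes from a signed sequence. -/
theorem exists_eq_pos {P : Set (Wt m n)} (hP : IsPositiveSystem P) :
    ∃ D : SignedSeq m n, P = D.pos := by
  obtain ⟨f, hf, rfl⟩ := hP
  set g : Lab m n → ℝ := fun a => f (Pi.single a 1) with hg
  let e0 : Fin (n + m) ≃ Lab m n := finSumFinEquiv.symm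
  -- Sorting in increasing order of the negated absolute value puts the largest absolute values
  -- first.
  let σ := Tuple.sort fun k => -|g (e0 k)|
  have hσ : Monotone ((fun k => -|g (e0 k)|) ∘ σ) := Tuple.monotone_sort _
  let D : SignedSeq m n :=
    { lab := σ.trans e0
      sign := fun k => if 0 ≤ g (e0 (σ k)) then 1 else -1 }
  let w : Fin (n + m) → ℝ := fun k => |g (D.lab k)|
  have hws : ∀ k, w k * ((D.sign k : ℤ) : ℝ) = g (D.lab k) := by
    intro k
    change |g (D.lab k)| * (((if 0 ≤ g (D.lab k) then 1 else -1 : ℤˣ) : ℤ) : ℝ) = _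
    split_ifs with h
    · rw [abs_of_nonneg h]; simp
    · rw [abs_of_neg (not_le.1 h)]; simp
  have hfD : f = D.height w := by
    refine DFunLike.ext _ _ fun α => ?_
    rw [map_eq_sum_single, height_apply, ← Equiv.sum_comp D.lab]
    refine Finset.sum_congr rfl fun k _ => ?_
    push_cast
    rw [← mul_assoc, hws, mul_comm]
  refine ⟨D, ?_⟩
  have hroot : ∀ (a b : Lab m n) (s : ℤˣ), a ≠ b → g a - (s : ℤ) * g b ≠ 0 := by
    intro a b s hab
    have h1 : wt (a, 1) - wt (b, s) ∈ roots m n := mem_roots_iff.2 ⟨_, _, rfl, Or.inl hab⟩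
    have h2 : (wt (b, s) : Wt m n) = (s : ℤ) • Pi.single b 1 := by
      rw [wt, ← Pi.single_smul, smul_eq_mul, mul_one]
    have := hf _ h1
    rw [map_sub, h2, map_zsmul, zsmul_eq_mul] at this
    exact this
  have hD : D.Dominant w := by
    refine ⟨fun i j hij => ?_, fun i hi => ?_⟩
    · have hle : |g (D.lab j)| ≤ |g (D.lab i)| := neg_le_neg_iff.1 (hσ hij.le)
      change |(|g (D.lab j)|)| < |g (D.lab i)|
      rw [abs_abs]
      -- Equal absolute values at two labels would make the functional vanish on the difference or
      -- the sum of the labels, which is a root.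
      refine lt_of_le_of_ne hle fun h => ?_
      have hne : D.lab j ≠ D.lab i := fun h => hij.ne (D.lab.injective h).symm
      rcases abs_eq_abs.1 h with h | h
      · exact hroot _ _ 1 hne (by rw [h]; simp)
      · exact hroot _ _ (-1) hne (by rw [h]; simp)
    · refine abs_pos.2 fun h0 => ?_
      have h1 : wt (D.lab i, 1) - wt (bar (D.lab i, 1)) ∈ roots m n :=
        mem_roots_iff.2 ⟨_, _, rfl, Or.inr ⟨rfl, hi⟩⟩
      refine hf _ h1 ?_
      have h2 : f (wt (D.lab i, 1)) = 0 := h0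
      rw [wt_bar, map_sub, map_neg, h2]; simp
  rw [← hD.posSys_eq, ← hfD]
  rfl

end SignedSeq

namespace SignedSeq

/-! ### Moves between signed sequences -/

/-- Rearrangement of a sequence, the signs moving along with the labels. -/
def perm (D : SignedSeq m n) (σ : Equiv.Perm (Fin (n + m))) : SignedSeq m n where
  lab := σ.trans D.lab
  sign := fun k => D.sign (σ k)

/-- Change of the sign in place `k`. -/
def flip (D : SignedSeq m n) (k : Fin (n + m)) : SignedSeq m n where
  lab := D.lab
  sign := fun i => if i = k then -D.sign i else D.sign i

theorem entry_perm (D : SignedSeq m n) (σ : Equiv.Perm (Fin (n + m))) (k : Fin (n + m)) :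
    (D.perm σ).entry k = D.entry (σ k) := rfl

theorem idx_perm (D : SignedSeq m n) (σ : Equiv.Perm (Fin (n + m))) (k : Fin (n + m)) :
    (D.perm σ).idx k = D.idx (σ k) := rfl

theorem entry_flip_self (D : SignedSeq m n) (k : Fin (n + m)) :
    (D.flip k).entry k = -D.entry k := by
  simp [entry, flip, Pi.single_neg]

theorem entry_flip_of_ne (D : SignedSeq m n) {k i : Fin (n + m)} (h : i ≠ k) :
    (D.flip k).entry i = D.entry i := by
  simp [entry, flip, h]

theorem epsSign_flip (D : SignedSeq m n) {k : Fin (n + m)} (hk : (D.lab k).isRight = true) :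
    (D.flip k).epsSign = -D.epsSign := by
  have h : ∀ i, (if (D.lab i).isRight = true then (if i = k then -D.sign i else D.sign i) else 1) =
      (if (D.lab i).isRight = true then D.sign i else 1) * (if i = k then -1 else 1) := by
    intro i
    by_cases hi : i = k
    · subst hi; simp [hk]
    · simp [hi]
  change ∏ i, (if (D.lab i).isRight = true then (if i = k then -D.sign i else D.sign i) else 1) = _
  rw [Finset.prod_congr rfl fun i _ => h i, Finset.prod_mul_distrib, Finset.prod_ite_eq']
  simp [epsSign]

/-- The sign of an `ε` in the last place does not matter for the positive system. -/
theorem pos_flip_last (D : SignedSeq m n) {k : Fin (n + m)} (hk : (k : ℕ) + 1 = n + m)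
    (hr : (D.lab k).isRight = true) : (D.flip k).pos = D.pos := by
  -- The shift gives the last entry the value 0, so its sign is invisible to the functional.
  -- Dominance survives because positivity is demanded only at δ's.
  let w : Fin (n + m) → ℝ := fun i => stdHeight m n i - 1
  have hw0 : w k = 0 := by
    have : ((k : ℕ) : ℝ) + 1 = ((n + m : ℕ) : ℝ) := by exact_mod_cast hk
    simp only [w, stdHeight]; linarith
  have hw : D.Dominant w := by
    refine ⟨fun i j hij => ?_, fun i hi => ?_⟩
    · have h1 := stdHeight_succ hij
      have h2 := one_le_stdHeight j
      rw [abs_of_nonneg (by simp only [w]; linarith)]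
      simp only [w]; linarith
    · have hne : i ≠ k := by
        rintro rfl
        rw [← Sum.not_isLeft, hi] at hr
        exact absurd hr (by decide)
      have hlt : i < k := by
        have := i.2
        have : (i : ℕ) ≠ k := fun h => hne (Fin.ext h)
        exact Fin.lt_def.2 (by omega)
      have h1 := stdHeight_succ hlt
      have h2 := one_le_stdHeight k
      simp only [w]; linarith
  have hw' : (D.flip k).Dominant w := hw
  rw [← hw.posSys_eq, ← hw'.posSys_eq]
  congr 1
  refine DFunLike.ext _ _ fun α => ?_
  rw [height_apply, height_apply]
  refine Finset.sum_congr rfl fun i _ => ?_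
  by_cases hi : i = k
  · rw [hi, hw0, zero_mul, zero_mul]
  · simp [flip, hi]

/-- An adjacent transposition inverts only the pair that it exchanges, so just one positive root
changes sign. -/
theorem swap_lt_swap {k l i j : Fin (n + m)} (hkl : (k : ℕ) + 1 = l) (hij : i < j)
    (hne : ¬ (i = k ∧ j = l)) : Equiv.swap k l i < Equiv.swap k l j := by
  have hij' := Fin.lt_def.1 hij
  simp only [Equiv.swap_apply_def]
  simp only [Fin.ext_iff] at hne
  split_ifs with h1 h2 h3 h4 h5 <;> simp only [Fin.ext_iff] at * <;> rw [Fin.lt_def] <;> omega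

theorem lt_of_succ {k l : Fin (n + m)} (hkl : (k : ℕ) + 1 = l) : k < l := Fin.lt_def.2 (by omega)

/-- If α - β were positive instead, then α = β + (α - β) would contradict simplicity. -/
theorem sub_mem_of_simple (D : SignedSeq m n) {α β : Wt m n} (hα : α ∈ D.simple)
    (hβ : β ∈ posSys (D.height (stdHeight m n))) (hr : β - α ∈ roots m n) :
    β - α ∈ posSys (D.height (stdHeight m n)) := by
  rw [← simpleRoots_pos, ← D.dominant_std.posSys_eq] at hα
  refine ⟨hr, lt_of_not_ge fun h => hα.2 ⟨β, hβ, α - β, ⟨?_, ?_⟩, by abel⟩⟩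
  · rw [← neg_sub]; exact neg_mem_roots hr
  · rw [← neg_sub, map_neg]
    exact neg_pos.2 (lt_of_le_of_ne h (D.dominant_std.height_ne_zero _ hr))

theorem adjacent_swap (D : SignedSeq m n) {k l : Fin (n + m)} (hkl : (k : ℕ) + 1 = l) :
    OspModule.Adjacent (D.height (stdHeight m n)) (D.perm (Equiv.swap k l)).pos
      (D.entry k - D.entry l) := by
  have hlt := lt_of_succ hkl
  have hα := D.sub_mem_pos hlt
  have hneg : -(D.entry k - D.entry l) ∈ (D.perm (Equiv.swap k l)).pos := by
    have := (D.perm (Equiv.swap k l)).sub_mem_pos hlt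
    rwa [entry_perm, entry_perm, Equiv.swap_apply_left, Equiv.swap_apply_right, ← neg_sub] at this
  refine ⟨?_, fun β hβ hr => D.sub_mem_of_simple (Or.inl (Or.inl ⟨k, l, hkl, rfl⟩)) hβ hr,
    fun β hβ => ?_⟩
  · rwa [(D.dominant_std).posSys_eq]
  · rw [(D.dominant_std).posSys_eq]
    have hne : β ≠ D.entry k - D.entry l := by
      rintro rfl
      exact neg_notMem_pos hβ hneg
    rcases hβ with ⟨i, j, hij, t, rfl⟩ | ⟨i, hi, rfl⟩
    · rw [entry_perm, entry_perm] at hne ⊢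
      by_cases hc : i = k ∧ j = l
      · obtain ⟨rfl, rfl⟩ := hc
        rw [Equiv.swap_apply_left, Equiv.swap_apply_right] at hne ⊢
        rcases Int.units_eq_one_or t with rfl | rfl
        · right
          refine ⟨?_, hne⟩
          rw [Units.val_one, one_smul, add_comm]
          exact D.add_mem_pos hij
        · left
          rw [Units.val_neg, Units.val_one, neg_smul, one_smul]; abel
      · exact Or.inr ⟨Or.inl ⟨_, _, swap_lt_swap hkl hij hc, t, rfl⟩, hne⟩
    · exact Or.inr ⟨Or.inr ⟨_, hi, rfl⟩, hne⟩

theorem adjacent_flip (D : SignedSeq m n) {k : Fin (n + m)} (hk : (k : ℕ) + 1 = n + m)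
    (hl : (D.lab k).isLeft = true) :
    OspModule.Adjacent (D.height (stdHeight m n)) (D.flip k).pos ((2 : ℤ) • D.entry k) := by
  have hα := D.two_smul_mem_pos hl
  have hneg : -((2 : ℤ) • D.entry k) ∈ (D.flip k).pos := by
    have := (D.flip k).two_smul_mem_pos (i := k) hl
    rwa [entry_flip_self, smul_neg] at this
  have hlt : ∀ {i j : Fin (n + m)}, i < j → i ≠ k := by
    rintro i j hij rfl
    have := Fin.lt_def.1 hij
    omega
  refine ⟨?_, fun β hβ hr => D.sub_mem_of_simple
    (Or.inl (Or.inr ⟨k, hk, hl, by rw [two_smul, two_nsmul]⟩)) hβ hr, fun β hβ => ?_⟩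
  · rwa [(D.dominant_std).posSys_eq]
  · rw [(D.dominant_std).posSys_eq]
    have hne : β ≠ (2 : ℤ) • D.entry k := by
      rintro rfl
      exact neg_notMem_pos hβ hneg
    rcases hβ with ⟨i, j, hij, t, rfl⟩ | ⟨i, hi, rfl⟩
    · right
      refine ⟨?_, hne⟩
      rw [entry_flip_of_ne _ (hlt hij)]
      by_cases hj : j = k
      · subst hj
        rw [entry_flip_self]
        exact Or.inl ⟨i, j, hij, -t, by simp⟩
      · rw [entry_flip_of_ne _ hj]
        exact Or.inl ⟨i, j, hij, t, rfl⟩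
    · by_cases hi' : i = k
      · subst hi'
        left
        rw [entry_flip_self, smul_neg]
      · right
        refine ⟨?_, hne⟩
        rw [entry_flip_of_ne _ hi']
        exact Or.inr ⟨i, hi, rfl⟩

/-! ### Highest weights under the moves -/

section HighestWeight

variable {V : Type*} [AddCommGroup V] [Module ℂ V] {M : OspModule m n V}

theorem parity_idx_left (D : SignedSeq m n) {k : Fin (n + m)} (h : (D.lab k).isLeft = true) :
    parity (D.idx k) = 1 := by
  unfold parity idx
  rcases hk : D.lab k with a | a
  · rfl
  · rw [hk] at h; simp at h

theorem parity_idx_right (D : SignedSeq m n) {k : Fin (n + m)} (h : (D.lab k).isRight = true) :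
    parity (D.idx k) = 0 := by
  unfold parity idx
  rcases hk : D.lab k with a | a
  · rw [hk] at h; simp at h
  · rfl

theorem coeff_wt_self (a : Idx m n) : OspModule.coeff a (wt a) = 1 := by
  rw [OspModule.coeff_apply, wt_apply, if_pos rfl]
  rcases Int.units_eq_one_or a.2 with h | h <;> simp [h]

theorem coeff_wt_of_ne {a b : Idx m n} (h : a.1 ≠ b.1) : OspModule.coeff a (wt b) = 0 := by
  rw [OspModule.coeff_apply, wt_apply, if_neg h, mul_zero]

theorem exists_span {a b : Idx m n} (hab : a.1 ≠ b.1 ∨ (b = bar a ∧ a.1.isLeft = true)) :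
    ∃ e ∈ rootSpace (wt a - wt b), e.1 a b = 1 ∧
      ∀ x ∈ rootSpace (wt a - wt b), ∃ c : ℂ, x = c • e := by
  obtain ⟨e, he, h1, h⟩ := exists_rootVector hab
  exact ⟨e, he, h1, fun x hx => ⟨_, h x hx⟩⟩

/-- The difference of the two signed coefficients is the value of the coroot, for two δ's as well as
for two ε's. -/
theorem hw_swap_even (hM : M.IsIrreducible) (D : SignedSeq m n) {k l : Fin (n + m)}
    (hkl : (k : ℕ) + 1 = l) (hpar : parity (D.idx k) = parity (D.idx l)) {μ : Wt m n} {j : ℕ}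
    (hj : OspModule.coeff (D.idx k) μ - OspModule.coeff (D.idx l) μ = j)
    (hv : M.HasHighestWeight D.pos μ) :
    M.HasHighestWeight (D.perm (Equiv.swap k l)).pos (μ - (j : ℤ) • (D.entry k - D.entry l)) := by
  have hA := D.adjacent_swap hkl
  rw [← D.wt_idx k, ← D.wt_idx l] at hA ⊢
  have hab : (D.idx k).1 ≠ (D.idx l).1 := fun h => (lt_of_succ hkl).ne (D.lab.injective h)
  obtain ⟨e, he, he1, hs⟩ := exists_span (Or.inl hab)
  obtain ⟨y, hy, hy1, hs'⟩ := exists_span (Or.inl hab.symm)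
  have h0 : par (wt (D.idx k) - wt (D.idx l)) = 0 := by
    rw [par_wt_sub, hpar]; exact CharTwo.add_self_eq_zero _
  rw [← D.dominant_std.posSys_eq] at hv
  refine OspModule.even_reflection (χ := OspModule.coeff (D.idx k) - OspModule.coeff (D.idx l))
    (y := y) (e := e) hM D.dominant_std.height_ne_zero hA h0 ?_ (by rwa [neg_sub]) he hs
    (by rwa [neg_sub]) ?_ hj hv
  · rw [AddMonoidHom.sub_apply, map_sub, map_sub, coeff_wt_self, coeff_wt_self, coeff_wt_of_ne hab,
      coeff_wt_of_ne hab.symm]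
    norm_num
  · intro ν w hw
    rw [OspModule.bracket_short M hab he he1 hy hy1 hw, h0]
    simp [sgn]

/-- The form has opposite signs on the δ's and the ε's, so orthogonality to the odd root means that
the sum of the two signed coefficients vanishes. -/
theorem hw_swap_odd (hM : M.IsIrreducible) (D : SignedSeq m n) {k l : Fin (n + m)}
    (hkl : (k : ℕ) + 1 = l) (hpar : parity (D.idx k) + parity (D.idx l) = 1) {μ : Wt m n}
    (hv : M.HasHighestWeight D.pos μ) :
    M.HasHighestWeight (D.perm (Equiv.swap k l)).pos
      (if OspModule.coeff (D.idx k) μ + OspModule.coeff (D.idx l) μ = 0 then μ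
        else μ - (D.entry k - D.entry l)) := by
  have hA := D.adjacent_swap hkl
  rw [← D.wt_idx k, ← D.wt_idx l] at hA ⊢
  have hab : (D.idx k).1 ≠ (D.idx l).1 := fun h => (lt_of_succ hkl).ne (D.lab.injective h)
  obtain ⟨e, he, he1, hs⟩ := exists_span (Or.inl hab)
  obtain ⟨y, hy, hy1, hs'⟩ := exists_span (Or.inl hab.symm)
  have h0 : par (wt (D.idx k) - wt (D.idx l)) = 1 := by
    rw [par_wt_sub, hpar]
  rw [← D.dominant_std.posSys_eq] at hv
  refine OspModule.odd_reflection (χ := OspModule.coeff (D.idx k) + OspModule.coeff (D.idx l))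
    (y := y) (e := e) hM D.dominant_std.height_ne_zero hA h0 (by rwa [neg_sub]) he hs
    (by rwa [neg_sub]) ?_ hv
  intro ν w hw
  rw [OspModule.bracket_short M hab he he1 hy hy1 hw, h0]
  simp [sgn]

/-- For the long root, twice the last entry, the coroot value is the coefficient itself; subtracting
that multiple of the root negates the coordinate. -/
theorem hw_flip (hM : M.IsIrreducible) (D : SignedSeq m n) {k : Fin (n + m)}
    (hk : (k : ℕ) + 1 = n + m) (hl : (D.lab k).isLeft = true) {μ : Wt m n} {j : ℕ}
    (hj : OspModule.coeff (D.idx k) μ = j) (hv : M.HasHighestWeight D.pos μ) :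
    M.HasHighestWeight (D.flip k).pos (μ - (j : ℤ) • ((2 : ℤ) • D.entry k)) := by
  have hA := D.adjacent_flip hk hl
  have h2 : (2 : ℤ) • D.entry k = wt (D.idx k) - wt (bar (D.idx k)) := by
    rw [wt_bar, wt_idx, two_smul, sub_neg_eq_add]
  rw [h2] at hA ⊢
  obtain ⟨e, he, he1, hs⟩ := exists_span (a := D.idx k) (Or.inr ⟨rfl, hl⟩)
  obtain ⟨y, hy, hy1, hs'⟩ := exists_span (a := bar (D.idx k)) (b := D.idx k)
    (Or.inr ⟨(bar_bar _).symm, hl⟩)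
  have h0 : par (wt (D.idx k) - wt (bar (D.idx k))) = 0 := by
    rw [par_wt_sub, parity_bar]; exact CharTwo.add_self_eq_zero _
  rw [← D.dominant_std.posSys_eq] at hv
  refine OspModule.even_reflection (χ := OspModule.coeff (D.idx k))
    (y := y) (e := e) hM D.dominant_std.height_ne_zero hA h0 ?_ (by rwa [neg_sub]) he hs
    (by rwa [neg_sub]) ?_ hj hv
  · rw [wt_bar, sub_neg_eq_add, map_add, coeff_wt_self]
    norm_num
  · intro ν w hw
    rw [OspModule.bracket_long M he he1 hy hy1 hw, h0]
    simp [sgn]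

end HighestWeight

/-! ### The weights under the moves -/

theorem frob_left (D : SignedSeq m n) (lam : YoungDiagram) {k : Fin (n + m)}
    (h : (D.lab k).isLeft = true) :
    D.frob lam k = lam.rowLen (D.deltaBefore k) - D.epsBefore k := by
  unfold frob
  rcases hk : D.lab k with a | a
  · rfl
  · rw [hk] at h; simp at h

theorem frob_right (D : SignedSeq m n) (lam : YoungDiagram) {k : Fin (n + m)}
    (h : (D.lab k).isRight = true) :
    D.frob lam k = lam.colLen (D.epsBefore k) - D.deltaBefore k := by
  unfold frob
  rcases hk : D.lab k with a | a
  · rw [hk] at h; simp at h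
  · rfl

theorem weight_apply_lab (D : SignedSeq m n) (lam : YoungDiagram) (k : Fin (n + m)) :
    D.weight lam (D.lab k) = D.frob lam k * (D.sign k : ℤ) := by
  rw [weight, Finset.sum_apply, Finset.sum_eq_single k]
  · rw [Pi.smul_apply, entry_apply_lab, if_pos rfl, smul_eq_mul]
  · intro l _ hl
    rw [Pi.smul_apply, entry_apply_lab, if_neg hl.symm, smul_zero]
  · simp

theorem coeff_weight (D : SignedSeq m n) (lam : YoungDiagram) (k : Fin (n + m)) :
    OspModule.coeff (D.idx k) (D.weight lam) = D.frob lam k := by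
  rw [OspModule.coeff_apply]
  change (D.sign k : ℤ) * D.weight lam (D.lab k) = _
  rw [weight_apply_lab, mul_left_comm, sign_mul_self, mul_one]

theorem frob_flip (D : SignedSeq m n) (lam : YoungDiagram) (k i : Fin (n + m)) :
    (D.flip k).frob lam i = D.frob lam i := rfl

theorem weight_flip (D : SignedSeq m n) (lam : YoungDiagram) (k : Fin (n + m)) :
    (D.flip k).weight lam = D.weight lam - (D.frob lam k : ℤ) • ((2 : ℤ) • D.entry k) := by
  rw [sub_eq_add_neg, ← sub_eq_iff_eq_add', weight, weight, ← Finset.sum_sub_distrib,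
    Finset.sum_eq_single k]
  · rw [frob_flip, entry_flip_self]
    module
  · intro i _ hi
    rw [frob_flip, entry_flip_of_ne _ hi, sub_self]
  · simp

theorem card_filter_lt_succ {N : ℕ} (q : Fin N → Bool) {k l : Fin N} (hkl : (k : ℕ) + 1 = l) :
    (Finset.univ.filter fun i : Fin N => i < l ∧ q i = true).card =
      (Finset.univ.filter fun i : Fin N => i < k ∧ q i = true).card +
        if q k = true then 1 else 0 := by
  have h : ∀ i : Fin N, i < l ↔ i < k ∨ i = k := by
    intro i
    rw [Fin.lt_def, Fin.lt_def, Fin.ext_iff]; omega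
  split_ifs with hq
  · rw [← Finset.card_insert_of_notMem (a := k) (by simp)]
    congr 1
    ext i
    simp only [Finset.mem_filter, Finset.mem_univ, true_and, Finset.mem_insert, h]
    constructor
    · rintro ⟨h1 | h1, h2⟩
      · exact Or.inr ⟨h1, h2⟩
      · exact Or.inl h1
    · rintro (rfl | ⟨h1, h2⟩)
      · exact ⟨Or.inr rfl, hq⟩
      · exact ⟨Or.inl h1, h2⟩
  · rw [add_zero]
    congr 1
    ext i
    simp only [Finset.mem_filter, Finset.mem_univ, true_and, h]
    constructor
    · rintro ⟨h1 | rfl, h2⟩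
      · exact ⟨h1, h2⟩
      · exact absurd h2 hq
    · rintro ⟨h1, h2⟩
      exact ⟨Or.inl h1, h2⟩

theorem card_filter_lt_swap {N : ℕ} (q : Fin N → Bool) {k l i : Fin N} (hkl : (k : ℕ) + 1 = l)
    (hi : i ≠ l) :
    (Finset.univ.filter fun j : Fin N => j < i ∧ q (Equiv.swap k l j) = true).card =
      (Finset.univ.filter fun j : Fin N => j < i ∧ q j = true).card := by
  refine Finset.card_bijective (Equiv.swap k l) (Equiv.swap k l).bijective fun j => ?_
  simp only [Finset.mem_filter, Finset.mem_univ, true_and]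
  refine and_congr_left fun _ => ?_
  have hi' : (i : ℕ) ≠ l := fun h => hi (Fin.ext h)
  rw [Equiv.swap_apply_def]
  split_ifs with h1 h2
  · rw [h1, Fin.lt_def, Fin.lt_def]; omega
  · rw [h2, Fin.lt_def, Fin.lt_def]; omega
  · rfl

theorem deltaBefore_succ (D : SignedSeq m n) {k l : Fin (n + m)} (hkl : (k : ℕ) + 1 = l) :
    D.deltaBefore l = D.deltaBefore k + if (D.lab k).isLeft = true then 1 else 0 :=
  card_filter_lt_succ (fun i => (D.lab i).isLeft) hkl

theorem epsBefore_succ (D : SignedSeq m n) {k l : Fin (n + m)} (hkl : (k : ℕ) + 1 = l) :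
    D.epsBefore l = D.epsBefore k + if (D.lab k).isRight = true then 1 else 0 :=
  card_filter_lt_succ (fun i => (D.lab i).isRight) hkl

theorem deltaBefore_swap (D : SignedSeq m n) {k l i : Fin (n + m)} (hkl : (k : ℕ) + 1 = l)
    (hi : i ≠ l) : (D.perm (Equiv.swap k l)).deltaBefore i = D.deltaBefore i :=
  card_filter_lt_swap (fun i => (D.lab i).isLeft) hkl hi

theorem epsBefore_swap (D : SignedSeq m n) {k l i : Fin (n + m)} (hkl : (k : ℕ) + 1 = l)
    (hi : i ≠ l) : (D.perm (Equiv.swap k l)).epsBefore i = D.epsBefore i :=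
  card_filter_lt_swap (fun i => (D.lab i).isRight) hkl hi

/-- Counts before the other places are unaffected by an adjacent exchange, so only the two exchanged
entries contribute to the difference. -/
theorem weight_swap (D : SignedSeq m n) (lam : YoungDiagram) {k l : Fin (n + m)}
    (hkl : (k : ℕ) + 1 = l) :
    (D.perm (Equiv.swap k l)).weight lam = D.weight lam +
      (((D.perm (Equiv.swap k l)).frob lam l - D.frob lam k : ℤ) • D.entry k +
       ((D.perm (Equiv.swap k l)).frob lam k - D.frob lam l : ℤ) • D.entry l) := by
  have hlt := lt_of_succ hkl
  rw [← sub_eq_iff_eq_add']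
  have h1 : (D.perm (Equiv.swap k l)).weight lam =
      ∑ i, ((D.perm (Equiv.swap k l)).frob lam (Equiv.swap k l i) : ℤ) • D.entry i := by
    rw [weight, ← Equiv.sum_comp (Equiv.swap k l)]
    refine Finset.sum_congr rfl fun i _ => ?_
    rw [entry_perm, Equiv.swap_apply_self]
  rw [h1, weight, ← Finset.sum_sub_distrib, Fintype.sum_eq_add k l hlt.ne]
  · rw [Equiv.swap_apply_left, Equiv.swap_apply_right, sub_smul, sub_smul]
  · rintro i ⟨hik, hil⟩
    rw [Equiv.swap_apply_of_ne_of_ne hik hil]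
    have h2 : (D.perm (Equiv.swap k l)).lab i = D.lab i := by
      change D.lab (Equiv.swap k l i) = _
      rw [Equiv.swap_apply_of_ne_of_ne hik hil]
    rw [frob, frob, h2, deltaBefore_swap D hkl hil, epsBefore_swap D hkl hil, sub_self]

theorem isRight_of_not_isLeft {α β : Type*} {x : α ⊕ β} (h : ¬ x.isLeft = true) :
    x.isRight = true := by
  rcases x with x | x
  · simp at h
  · rfl

theorem lab_swap_left (D : SignedSeq m n) (k l : Fin (n + m)) :
    (D.perm (Equiv.swap k l)).lab k = D.lab l := by
  change D.lab (Equiv.swap k l k) = _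
  rw [Equiv.swap_apply_left]

theorem lab_swap_right (D : SignedSeq m n) (k l : Fin (n + m)) :
    (D.perm (Equiv.swap k l)).lab l = D.lab k := by
  change D.lab (Equiv.swap k l l) = _
  rw [Equiv.swap_apply_right]

/-- Swapping neighbours of the same kind keeps the coordinates, which decrease. -/
theorem frob_swap_same (D : SignedSeq m n) (lam : YoungDiagram) {k l : Fin (n + m)}
    (hkl : (k : ℕ) + 1 = l) (h : (D.lab k).isLeft = (D.lab l).isLeft) :
    (D.perm (Equiv.swap k l)).frob lam k = D.frob lam k ∧
      (D.perm (Equiv.swap k l)).frob lam l = D.frob lam l ∧ D.frob lam l ≤ D.frob lam k := by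
  have hne := (lt_of_succ hkl).ne
  have d1 := D.deltaBefore_succ hkl
  have d2 := (D.perm (Equiv.swap k l)).deltaBefore_succ hkl
  have e1 := D.epsBefore_succ hkl
  have e2 := (D.perm (Equiv.swap k l)).epsBefore_succ hkl
  rw [deltaBefore_swap D hkl hne, lab_swap_left] at d2
  rw [epsBefore_swap D hkl hne, lab_swap_left] at e2
  by_cases hk : (D.lab k).isLeft = true
  · have hl : (D.lab l).isLeft = true := h ▸ hk
    have hk' : ¬ (D.lab k).isRight = true := by rw [← Sum.not_isLeft, hk]; decide
    have hl' : ¬ (D.lab l).isRight = true := by rw [← Sum.not_isLeft, hl]; decide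
    rw [if_pos hk] at d1
    rw [if_pos hl] at d2
    rw [if_neg hk', add_zero] at e1
    rw [if_neg hl', add_zero] at e2
    rw [frob_left _ _ (by rwa [lab_swap_left] : ((D.perm (Equiv.swap k l)).lab k).isLeft = true),
      frob_left _ _ (by rwa [lab_swap_right] : ((D.perm (Equiv.swap k l)).lab l).isLeft = true),
      frob_left _ _ hk, frob_left _ _ hl, deltaBefore_swap D hkl hne, epsBefore_swap D hkl hne,
      d1, d2, e1, e2]
    exact ⟨rfl, rfl, Nat.sub_le_sub_right (lam.rowLen_anti _ _ (Nat.le_succ _)) _⟩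
  · have hl : ¬ (D.lab l).isLeft = true := h ▸ hk
    have hk' := isRight_of_not_isLeft hk
    have hl' := isRight_of_not_isLeft hl
    rw [if_neg hk, add_zero] at d1
    rw [if_neg hl, add_zero] at d2
    rw [if_pos hk'] at e1
    rw [if_pos hl'] at e2
    rw [frob_right _ _ (by rwa [lab_swap_left] : ((D.perm (Equiv.swap k l)).lab k).isRight = true),
      frob_right _ _ (by rwa [lab_swap_right] : ((D.perm (Equiv.swap k l)).lab l).isRight = true),
      frob_right _ _ hk', frob_right _ _ hl', deltaBefore_swap D hkl hne, epsBefore_swap D hkl hne,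
      d1, d2, e1, e2]
    exact ⟨rfl, rfl, Nat.sub_le_sub_right (lam.colLen_anti _ _ (Nat.le_succ _)) _⟩

/-- Swapping neighbours of different kind. -/
theorem frob_swap_diff (D : SignedSeq m n) (lam : YoungDiagram) {k l : Fin (n + m)}
    (hkl : (k : ℕ) + 1 = l) (h : (D.lab k).isLeft ≠ (D.lab l).isLeft) :
    (D.frob lam k + D.frob lam l = 0 ∧ (D.perm (Equiv.swap k l)).frob lam l = D.frob lam k ∧
      (D.perm (Equiv.swap k l)).frob lam k = D.frob lam l) ∨
    (D.frob lam k + D.frob lam l ≠ 0 ∧ (D.perm (Equiv.swap k l)).frob lam l + 1 = D.frob lam k ∧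
      (D.perm (Equiv.swap k l)).frob lam k = D.frob lam l + 1) := by
  have hne := (lt_of_succ hkl).ne
  have d1 := D.deltaBefore_succ hkl
  have d2 := (D.perm (Equiv.swap k l)).deltaBefore_succ hkl
  have e1 := D.epsBefore_succ hkl
  have e2 := (D.perm (Equiv.swap k l)).epsBefore_succ hkl
  rw [deltaBefore_swap D hkl hne, lab_swap_left] at d2
  rw [epsBefore_swap D hkl hne, lab_swap_left] at e2
  have hbox : ∀ d e, e < lam.rowLen d ↔ d < lam.colLen e := fun d e => by
    rw [← YoungDiagram.mem_iff_lt_rowLen, ← YoungDiagram.mem_iff_lt_colLen]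
  -- This box lies in λ exactly when the coordinate at `k` is positive, whichever kind stands there;
  -- outside λ both coordinates are zero.
  have hb := hbox (D.deltaBefore k) (D.epsBefore k)
  by_cases hk : (D.lab k).isLeft = true
  · have hl : ¬ (D.lab l).isLeft = true := fun h2 => h (hk.trans h2.symm)
    have hk' : ¬ (D.lab k).isRight = true := by rw [← Sum.not_isLeft, hk]; decide
    have hl' := isRight_of_not_isLeft hl
    rw [if_pos hk] at d1
    rw [if_neg hl, add_zero] at d2
    rw [if_neg hk', add_zero] at e1
    rw [if_pos hl'] at e2
    rw [frob_right _ _ (by rwa [lab_swap_left] : ((D.perm (Equiv.swap k l)).lab k).isRight = true),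
      frob_left _ _ (by rwa [lab_swap_right] : ((D.perm (Equiv.swap k l)).lab l).isLeft = true),
      frob_left _ _ hk, frob_right _ _ hl', deltaBefore_swap D hkl hne, epsBefore_swap D hkl hne,
      d1, d2, e1, e2]
    omega
  · have hl : (D.lab l).isLeft = true := by
      by_contra h2
      rw [Bool.not_eq_true] at hk h2
      exact h (hk.trans h2.symm)
    have hl' : ¬ (D.lab l).isRight = true := by rw [← Sum.not_isLeft, hl]; decide
    have hk' := isRight_of_not_isLeft hk
    rw [if_neg hk, add_zero] at d1
    rw [if_pos hl] at d2
    rw [if_pos hk'] at e1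
    rw [if_neg hl', add_zero] at e2
    rw [frob_left _ _ (by rwa [lab_swap_left] : ((D.perm (Equiv.swap k l)).lab k).isLeft = true),
      frob_right _ _ (by rwa [lab_swap_right] : ((D.perm (Equiv.swap k l)).lab l).isRight = true),
      frob_right _ _ hk', frob_left _ _ hl, deltaBefore_swap D hkl hne, epsBefore_swap D hkl hne,
      d1, d2, e1, e2]
    omega

section Weights

variable {V : Type*} [AddCommGroup V] [Module ℂ V] {M : OspModule m n V} {lam : YoungDiagram}

/-- For one kind the coordinates weakly decrease, so the string length of the even reflection is a
natural number. For different kinds the two cases of the odd reflection match the two cases for the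
box. -/
theorem hw_weight_swap (hM : M.IsIrreducible) (D : SignedSeq m n) {k l : Fin (n + m)}
    (hkl : (k : ℕ) + 1 = l) (hv : M.HasHighestWeight D.pos (D.weight lam)) :
    M.HasHighestWeight (D.perm (Equiv.swap k l)).pos ((D.perm (Equiv.swap k l)).weight lam) := by
  rw [weight_swap D lam hkl]
  by_cases h : (D.lab k).isLeft = (D.lab l).isLeft
  · obtain ⟨h1, h2, h3⟩ := frob_swap_same D lam hkl h
    have hp : parity (D.idx k) = parity (D.idx l) := by
      by_cases hk : (D.lab k).isLeft = true
      · rw [parity_idx_left D hk, parity_idx_left D (h ▸ hk)]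
      · rw [parity_idx_right D (isRight_of_not_isLeft hk),
          parity_idx_right D (isRight_of_not_isLeft (h ▸ hk))]
    have := hw_swap_even hM D hkl hp (j := D.frob lam k - D.frob lam l)
      (by rw [coeff_weight, coeff_weight, Nat.cast_sub h3]) hv
    convert this using 1
    rw [h1, h2, Nat.cast_sub h3]
    module
  · have hp : parity (D.idx k) + parity (D.idx l) = 1 := by
      by_cases hk : (D.lab k).isLeft = true
      · rw [parity_idx_left D hk, parity_idx_right D
          (isRight_of_not_isLeft fun h2 => h (hk.trans h2.symm)), add_zero]
      · have hl : (D.lab l).isLeft = true := by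
          by_contra h2
          rw [Bool.not_eq_true] at hk h2
          exact h (hk.trans h2.symm)
        rw [parity_idx_right D (isRight_of_not_isLeft hk), parity_idx_left D hl, zero_add]
    have := hw_swap_odd hM D hkl hp hv
    rw [coeff_weight, coeff_weight] at this
    rcases frob_swap_diff D lam hkl h with ⟨h0, h1, h2⟩ | ⟨h0, h1, h2⟩
    · rw [if_pos (by exact_mod_cast h0)] at this
      rw [h1, h2]
      simpa using this
    · rw [if_neg (by exact_mod_cast h0)] at this
      convert this using 1
      rw [h2, ← h1]
      push_cast
      module

theorem hw_weight_flip (hM : M.IsIrreducible) (D : SignedSeq m n) {k : Fin (n + m)}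
    (hk : (k : ℕ) + 1 = n + m) (hl : (D.lab k).isLeft = true)
    (hv : M.HasHighestWeight D.pos (D.weight lam)) :
    M.HasHighestWeight (D.flip k).pos ((D.flip k).weight lam) := by
  rw [weight_flip]
  exact hw_flip hM D hk hl (coeff_weight D lam k) hv

/-- Negating two final ε's is the product of the commuting reflections in the sum and in the
difference of the last two entries. -/
theorem hw_weight_flip_pair (hM : M.IsIrreducible) (D : SignedSeq m n) {k l : Fin (n + m)}
    (hkl : (k : ℕ) + 1 = l) (hl : (l : ℕ) + 1 = n + m) (hrk : (D.lab k).isRight = true)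
    (hrl : (D.lab l).isRight = true) (hv : M.HasHighestWeight D.pos (D.weight lam)) :
    M.HasHighestWeight ((D.flip k).flip l).pos (((D.flip k).flip l).weight lam) := by
  have hne : k ≠ l := (lt_of_succ hkl).ne
  have hleft : (D.lab k).isLeft = (D.lab l).isLeft := by
    rw [← Sum.bnot_isRight, ← Sum.bnot_isRight, hrk, hrl]
  have hle := (frob_swap_same D lam hkl hleft).2.2
  have cneg : ∀ (E : SignedSeq m n) (i : Fin (n + m)) (ν : Wt m n),
      OspModule.coeff ((E.flip i).idx i) ν = -OspModule.coeff (E.idx i) ν := by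
    intro E i ν
    simp [OspModule.coeff_apply, idx, flip]
  have cself : ∀ (E : SignedSeq m n) (i j : Fin (n + m)) (ν : Wt m n), j ≠ i →
      OspModule.coeff ((E.flip i).idx j) ν = OspModule.coeff (E.idx j) ν := by
    intro E i j ν h
    simp [OspModule.coeff_apply, idx, flip, h]
  have cE : ∀ i j : Fin (n + m), OspModule.coeff (D.idx i) (D.entry j) = if i = j then 1 else 0 := by
    intro i j
    split_ifs with h
    · subst h; exact coeff_wt_self _
    · exact coeff_wt_of_ne (a := D.idx i) (b := D.idx j) fun h2 => h (D.lab.injective h2)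
  -- change the last sign, swap, change the last sign, swap again
  rw [← D.pos_flip_last hl hrl] at hv
  have p1 : parity ((D.flip l).idx k) = parity ((D.flip l).idx l) := by
    rw [parity_idx_right (D.flip l) hrk, parity_idx_right (D.flip l) hrl]
  -- With the last sign negated, the simple root to be reflected is the sum of the two entries, and
  -- the string length is the sum of their coordinates.
  have h1 := hw_swap_even hM (D.flip l) hkl p1 (j := D.frob lam k + D.frob lam l)
    (by rw [cneg, cself _ _ _ _ hne, coeff_weight, coeff_weight]; push_cast; ring) hv
  rw [entry_flip_self, entry_flip_of_ne _ hne] at h1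
  set E := (D.flip l).perm (Equiv.swap k l) with hE
  have hEr : (E.lab l).isRight = true := by
    rw [hE, lab_swap_right]; exact hrk
  have hEr' : (E.lab k).isRight = true := by
    rw [hE, lab_swap_left]; exact hrl
  rw [← E.pos_flip_last hl hEr] at h1
  have p2 : parity ((E.flip l).idx k) = parity ((E.flip l).idx l) := by
    rw [parity_idx_right (E.flip l) hEr', parity_idx_right (E.flip l) hEr]
  have i1 : E.idx k = (D.flip l).idx l := by
    rw [hE, idx_perm, Equiv.swap_apply_left]
  have i2 : E.idx l = (D.flip l).idx k := by
    rw [hE, idx_perm, Equiv.swap_apply_right]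
  -- Now the last two entries are the negatives of the original ones in reverse order. Their
  -- coefficients are the original coordinates of `k` and `l`, in this order, so the string length
  -- is a natural number.
  have h2 := hw_swap_even hM (E.flip l) hkl p2 (j := D.frob lam k - D.frob lam l) (by
    rw [cneg, cself _ _ _ _ hne, i1, i2, cneg, cself _ _ _ _ hne]
    simp only [map_sub, map_zsmul, map_neg, coeff_weight, cE, if_true, if_neg hne, if_neg hne.symm]
    rw [Nat.cast_sub hle]
    push_cast
    ring) h1
  have g1 : (E.flip l).entry k = -D.entry l := by
    rw [entry_flip_of_ne _ hne, hE, entry_perm, Equiv.swap_apply_left, entry_flip_self]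
  have g2 : (E.flip l).entry l = -D.entry k := by
    rw [entry_flip_self, hE, entry_perm, Equiv.swap_apply_right, entry_flip_of_ne _ hne]
  have hfin : (E.flip l).perm (Equiv.swap k l) = (D.flip k).flip l := by
    rw [hE]
    simp only [perm, flip, mk.injEq]
    constructor
    · ext i; simp
    · funext i
      rw [Equiv.swap_apply_self]
      by_cases hik : i = k
      · subst hik; simp [hne]
      · by_cases hil : i = l
        · subst hil; simp [hne, hne.symm]
        · simp [hik, hil, Equiv.swap_apply_of_ne_of_ne hik hil]
  rw [hfin, g1, g2, Nat.cast_sub hle] at h2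
  convert h2 using 1
  rw [weight_flip, weight_flip, frob_flip, entry_flip_of_ne _ hne.symm]
  push_cast
  module

end Weights

end SignedSeq

namespace SignedSeq

/-! ### Connecting all signed sequences with the standard one -/

/-- The sequence with given arrangement and with given signs of the labels. -/
def ofSign (e : Fin (n + m) ≃ Lab m n) (ζ : Lab m n → ℤˣ) : SignedSeq m n := ⟨e, fun k => ζ (e k)⟩

theorem eq_ofSign (D : SignedSeq m n) : D = ofSign D.lab fun a => D.sign (D.lab.symm a) := by
  obtain ⟨e, s⟩ := D
  simp [ofSign]

theorem ofSign_flip (e : Fin (n + m) ≃ Lab m n) (ζ : Lab m n → ℤˣ) (k : Fin (n + m)) :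
    (ofSign e ζ).flip k = ofSign e (ζ * Pi.mulSingle (e k) (-1)) := by
  simp only [ofSign, flip, mk.injEq, true_and]
  funext i
  rw [Pi.mul_apply]
  by_cases hi : i = k
  · subst hi; simp
  · rw [if_neg hi, Pi.mulSingle_eq_of_ne fun h => hi (e.injective h), mul_one]

theorem ofSign_perm (e : Fin (n + m) ≃ Lab m n) (ζ : Lab m n → ℤˣ)
    (σ : Equiv.Perm (Fin (n + m))) : (ofSign e ζ).perm σ = ofSign (σ.trans e) ζ := rfl

theorem epsSign_ofSign (e : Fin (n + m) ≃ Lab m n) (ζ : Lab m n → ℤˣ) :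
    (ofSign e ζ).epsSign = ∏ j, ζ (Sum.inr j) := by
  change (∏ k, if (e k).isRight = true then ζ (e k) else 1) = _
  rw [Equiv.prod_comp e fun a => if a.isRight = true then ζ a else 1, Fintype.prod_sum_type]
  simp

theorem closure_adjacent_swaps (N : ℕ) :
    Submonoid.closure {σ : Equiv.Perm (Fin N) | ∃ k l : Fin N, (k : ℕ) + 1 = l ∧
      σ = Equiv.swap k l} = ⊤ := by
  cases N with
  | zero => exact Subsingleton.elim _ _
  | succ N =>
    rw [eq_top_iff, ← Equiv.Perm.mclosure_swap_castSucc_succ N]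
    refine Submonoid.closure_mono ?_
    rintro _ ⟨i, rfl⟩
    exact ⟨i.castSucc, i.succ, by simp, rfl⟩

section

variable {V : Type*} [AddCommGroup V] [Module ℂ V] {M : OspModule m n V} {lam : YoungDiagram}

theorem hw_weight_perm (hM : M.IsIrreducible) (σ : Equiv.Perm (Fin (n + m))) (D : SignedSeq m n)
    (hv : M.HasHighestWeight D.pos (D.weight lam)) :
    M.HasHighestWeight (D.perm σ).pos ((D.perm σ).weight lam) := by
  have hσ : σ ∈ Submonoid.closure {σ : Equiv.Perm (Fin (n + m)) | ∃ k l : Fin (n + m),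
      (k : ℕ) + 1 = l ∧ σ = Equiv.swap k l} := by
    rw [closure_adjacent_swaps]; trivial
  induction hσ using Submonoid.closure_induction generalizing D with
  | mem σ h =>
    obtain ⟨k, l, hkl, rfl⟩ := h
    exact hw_weight_swap hM D hkl hv
  | one => exact hv
  | mul σ τ _ _ h1 h2 =>
    have h : D.perm (σ * τ) = (D.perm σ).perm τ := rfl
    rw [h]
    exact h2 _ (h1 _ hv)

theorem hw_ofSign (hM : M.IsIrreducible) (e e' : Fin (n + m) ≃ Lab m n) (ζ : Lab m n → ℤˣ)
    (hv : M.HasHighestWeight (ofSign e ζ).pos ((ofSign e ζ).weight lam)) :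
    M.HasHighestWeight (ofSign e' ζ).pos ((ofSign e' ζ).weight lam) := by
  -- The signs are attached to the labels, so this permutation of places turns one arrangement into
  -- the other without changing them.
  have := hw_weight_perm hM (e'.trans e.symm) _ hv
  rw [ofSign_perm] at this
  have h : (Equiv.trans (e'.trans e.symm) e) = e' := by ext1 i; simp
  rwa [h] at this

theorem exists_equiv_apply (k : Fin (n + m)) (a : Lab m n) :
    ∃ e : Fin (n + m) ≃ Lab m n, e k = a :=
  ⟨(Equiv.swap k (finSumFinEquiv a)).trans finSumFinEquiv.symm, by simp⟩

/-- The changes of signs that keep the description of the highest weights valid. -/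
def signChanges (M : OspModule m n V) (lam : YoungDiagram) : Submonoid (Lab m n → ℤˣ) where
  carrier := {ξ | ∀ (e : Fin (n + m) ≃ Lab m n) (ζ : Lab m n → ℤˣ),
    M.HasHighestWeight (ofSign e ζ).pos ((ofSign e ζ).weight lam) →
    M.HasHighestWeight (ofSign e (ζ * ξ)).pos ((ofSign e (ζ * ξ)).weight lam)}
  mul_mem' := by
    intro ξ ξ' h h' e ζ hv
    rw [← mul_assoc]
    exact h' e _ (h e ζ hv)
  one_mem' := by
    intro e ζ hv
    rwa [mul_one]

/-- The label is moved to the last place, negated there by the long reflection, and moved back. -/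
theorem mulSingle_left_mem (hM : M.IsIrreducible) (i : Fin n) (u : ℤˣ) :
    Pi.mulSingle (Sum.inl i) u ∈ signChanges M lam := by
  rcases Int.units_eq_one_or u with rfl | rfl
  · rw [Pi.mulSingle_one]; exact one_mem _
  intro e ζ hv
  have hN : n + m - 1 < n + m := by have := i.2; omega
  obtain ⟨e', he'⟩ := exists_equiv_apply ⟨n + m - 1, hN⟩ (Sum.inl i : Lab m n)
  refine hw_ofSign hM e' e _ ?_
  rw [← he', ← ofSign_flip]
  refine hw_weight_flip hM _ ?_ ?_ (hw_ofSign hM e e' _ hv)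
  · change n + m - 1 + 1 = n + m
    omega
  · change (e' _).isLeft = true
    rw [he']; rfl

/-- The two labels are moved to the last two places, where the pair of negations is available, and
moved back. -/
theorem mulSingle_pair_mem (hM : M.IsIrreducible) {i j : Fin m} (hij : i ≠ j) (u : ℤˣ) :
    (Pi.mulSingle (Sum.inr i) u * Pi.mulSingle (Sum.inr j) u : Lab m n → ℤˣ) ∈
      signChanges M lam := by
  rcases Int.units_eq_one_or u with rfl | rfl
  · rw [Pi.mulSingle_one, Pi.mulSingle_one, mul_one]; exact one_mem _
  intro e ζ hv
  have hi := i.2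
  have hj := j.2
  have hij' : (i : ℕ) ≠ j := fun h => hij (Fin.ext h)
  have hN : n + m - 1 < n + m := by omega
  have hN' : n + m - 2 < n + m := by omega
  obtain ⟨e1, he1⟩ := exists_equiv_apply ⟨n + m - 1, hN⟩ (Sum.inr j : Lab m n)
  set k : Fin (n + m) := ⟨n + m - 2, hN'⟩ with hk
  set l : Fin (n + m) := ⟨n + m - 1, hN⟩ with hl
  have hkl : k ≠ l := fun h => by
    have := congrArg Fin.val h
    change n + m - 2 = n + m - 1 at this
    omega
  let e' : Fin (n + m) ≃ Lab m n := (Equiv.swap k (e1.symm (Sum.inr i))).trans e1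
  have h1 : e' k = Sum.inr i := by simp [e']
  have h2 : e' l = Sum.inr j := by
    have : l ≠ e1.symm (Sum.inr i) := by
      intro h
      rw [h, Equiv.apply_symm_apply] at he1
      exact hij (Sum.inr_injective he1)
    change e1 (Equiv.swap k (e1.symm (Sum.inr i)) l) = _
    rw [Equiv.swap_apply_of_ne_of_ne hkl.symm this, he1]
  refine hw_ofSign hM e' e _ ?_
  rw [← mul_assoc, ← h1, ← h2, ← ofSign_flip, ← ofSign_flip]
  refine hw_weight_flip_pair hM _ ?_ ?_ ?_ ?_ (hw_ofSign hM e e' _ hv)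
  · change n + m - 2 + 1 = n + m - 1
    omega
  · change n + m - 1 + 1 = n + m
    omega
  · change (e' k).isRight = true
    rw [h1]; rfl
  · change (e' l).isRight = true
    rw [h2]; rfl

theorem mem_signChanges (hM : M.IsIrreducible) {ξ : Lab m n → ℤˣ}
    (h : ∏ j, ξ (Sum.inr j) = 1) : ξ ∈ signChanges M lam := by
  rw [← Finset.univ_prod_mulSingle ξ, Fintype.prod_sum_type]
  refine mul_mem (Submonoid.prod_mem _ fun i _ => mulSingle_left_mem hM i _) ?_
  cases m with
  | zero => simp [one_mem]
  | succ m =>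
    -- Each ε-sign is paired with a copy at ε₁, cancelled by a second copy. The second copies
    -- multiply to the product of all ε-signs, which is 1.
    have h1 : ∀ j : Fin (m + 1), (Pi.mulSingle (Sum.inr j) (ξ (Sum.inr j)) : Lab (m + 1) n → ℤˣ) =
        (Pi.mulSingle (Sum.inr j) (ξ (Sum.inr j)) *
          Pi.mulSingle (Sum.inr 0) (ξ (Sum.inr j))) *
          Pi.mulSingle (Sum.inr 0) (ξ (Sum.inr j)) := by
      intro j
      rw [mul_assoc, ← Pi.mulSingle_mul, Int.units_mul_self, Pi.mulSingle_one, mul_one]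
    rw [Finset.prod_congr rfl fun j _ => h1 j, Finset.prod_mul_distrib]
    have h2 : (∏ j, Pi.mulSingle (Sum.inr 0) (ξ (Sum.inr j)) : Lab (m + 1) n → ℤˣ) =
        Pi.mulSingle (Sum.inr 0) (∏ j, ξ (Sum.inr j)) :=
      (map_prod (MonoidHom.mulSingle (fun _ : Lab (m + 1) n => ℤˣ) (Sum.inr 0)) _ _).symm
    rw [h2, h, Pi.mulSingle_one, mul_one]
    refine Submonoid.prod_mem _ fun j _ => ?_
    by_cases hj : j = 0
    · subst hj
      rw [← Pi.mulSingle_mul, Int.units_mul_self, Pi.mulSingle_one]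
      exact one_mem _
    · exact mulSingle_pair_mem hM hj _

/-- The description of the highest weight passes between sequences with equal `ε`-signs. -/
theorem hw_weight_of_epsSign_eq (hM : M.IsIrreducible) {D E : SignedSeq m n}
    (h : D.epsSign = E.epsSign) (hv : M.HasHighestWeight D.pos (D.weight lam)) :
    M.HasHighestWeight E.pos (E.weight lam) := by
  rw [D.eq_ofSign] at hv h
  rw [E.eq_ofSign] at h ⊢
  set ζ := fun a => D.sign (D.lab.symm a)
  set ζ' := fun a => E.sign (E.lab.symm a)
  rw [epsSign_ofSign, epsSign_ofSign] at h
  have hξ : ζ * ζ' ∈ signChanges M lam := by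
    apply mem_signChanges hM
    simp only [Pi.mul_apply]
    rw [Finset.prod_mul_distrib, h, Int.units_mul_self]
  have h2 : ζ * (ζ * ζ') = ζ' := by
    funext a
    rw [← mul_assoc, Pi.mul_apply, Pi.mul_apply, Int.units_mul_self, one_mul]
  have := hξ _ _ (hw_ofSign hM _ E.lab _ hv)
  rwa [h2] at this

end

/-! ### The standard sequence -/

theorem card_cells_below (lam : YoungDiagram) (n j : ℕ) :
    (lam.cells.filter fun c => n ≤ c.1 ∧ c.2 = j).card = lam.colLen j - n := by
  rw [← Nat.card_Ico]
  refine Finset.card_nbij' (fun c => c.1) (fun i => (i, j)) ?_ ?_ ?_ ?_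
  · intro c hc
    simp only [Finset.coe_filter, Set.mem_ofPred_eq, YoungDiagram.mem_cells] at hc
    obtain ⟨h1, h2, h3⟩ := hc
    simp only [Finset.coe_Ico, Set.mem_Ico]
    rw [← h3]
    exact ⟨h2, YoungDiagram.mem_iff_lt_colLen.1 h1⟩
  · intro i hi
    simp only [Finset.coe_Ico, Set.mem_Ico] at hi
    simp only [Finset.coe_filter, Set.mem_ofPred_eq, YoungDiagram.mem_cells]
    exact ⟨YoungDiagram.mem_iff_lt_colLen.2 hi.2, hi.1, trivial⟩
  · intro c hc
    simp only [Finset.coe_filter, Set.mem_ofPred_eq] at hc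
    exact Prod.ext rfl hc.2.2.symm
  · intro i _
    rfl

/-- No ε precedes a δ and all `n` δ's precede every ε, so truncated subtraction counts the cells of
a column below row `n`. -/
theorem weight_standard (lam : YoungDiagram) : (standard m n).weight lam = hash m n lam := by
  funext a
  obtain ⟨k, rfl⟩ := (standard m n).lab.surjective a
  rw [weight_apply_lab]
  change ((standard m n).frob lam k : ℤ) * ((1 : ℤˣ) : ℤ) = _
  rw [Units.val_one, mul_one]
  have hd : ∀ k : Fin (n + m), (standard m n).deltaBefore k =
      (Finset.univ.filter fun i : Fin n => Fin.castAdd m i < k).card := by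
    intro k
    rw [deltaBefore, Finset.card_filter, Finset.card_filter,
      ← Equiv.sum_comp finSumFinEquiv, Fintype.sum_sum_type]
    simp [standard]
  have he : ∀ k : Fin (n + m), (standard m n).epsBefore k =
      (Finset.univ.filter fun j : Fin m => Fin.natAdd n j < k).card := by
    intro k
    rw [epsBefore, Finset.card_filter, Finset.card_filter,
      ← Equiv.sum_comp finSumFinEquiv, Fintype.sum_sum_type]
    simp [standard]
  obtain ⟨a, rfl⟩ := (finSumFinEquiv (m := n) (n := m)).surjective k
  have hlab : (standard m n).lab (finSumFinEquiv a) = a := by simp [standard]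
  rw [hlab]
  rcases a with i | j
  · rw [frob_left _ _ (by rw [hlab]; rfl), hd, he, finSumFinEquiv_apply_left]
    have h1 : (Finset.univ.filter fun i' : Fin n => Fin.castAdd m i' < Fin.castAdd m i) =
        Finset.Iio i := by
      ext i'
      rw [Finset.mem_filter, Finset.mem_Iio, Fin.lt_def, Fin.lt_def]
      simp
    have h2 : (Finset.univ.filter fun j : Fin m => Fin.natAdd n j < Fin.castAdd m i) = ∅ := by
      ext j
      simp only [Finset.mem_filter, Finset.mem_univ, true_and, Finset.notMem_empty, iff_false,
        not_lt, Fin.le_def, Fin.val_castAdd, Fin.val_natAdd]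
      have := i.2
      omega
    rw [h1, h2, Fin.card_Iio, Finset.card_empty, Nat.sub_zero]
    rfl
  · rw [frob_right _ _ (by rw [hlab]; rfl), hd, he, finSumFinEquiv_apply_right]
    have h1 : (Finset.univ.filter fun j' : Fin m => Fin.natAdd n j' < Fin.natAdd n j) =
        Finset.Iio j := by
      ext j'; simp
    have h2 : (Finset.univ.filter fun i : Fin n => Fin.castAdd m i < Fin.natAdd n j) =
        Finset.univ := by
      ext i
      simp only [Finset.mem_filter, Finset.mem_univ, true_and, iff_true, Fin.lt_def,
        Fin.val_castAdd, Fin.val_natAdd]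
      have := i.2
      omega
    rw [h1, h2, Fin.card_Iio, Finset.card_univ, Fintype.card_fin]
    change _ = ((lam.cells.filter fun c => n ≤ c.1 ∧ c.2 = (j : ℕ)).card : ℤ)
    rw [card_cells_below]

theorem epsSign_standard : (standard m n).epsSign = 1 :=
  Finset.prod_eq_one fun _ _ => ite_self _

theorem isRight_standard {k : Fin (n + m)} (hk : (k : ℕ) + 1 = n + m) (hm : 0 < m) :
    (standard m n).lab k = Sum.inr ⟨m - 1, by omega⟩ := by
  change finSumFinEquiv.symm k = _
  rw [Equiv.symm_apply_eq, finSumFinEquiv_apply_right]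
  ext
  rw [Fin.val_natAdd]
  change (k : ℕ) = n + (m - 1)
  omega

theorem weight_standard_flip (lam : YoungDiagram) {k : Fin (n + m)} (hk : (k : ℕ) + 1 = n + m)
    (hm : 0 < m) : ((standard m n).flip k).weight lam = hashMinus m n lam := by
  have hlab := isRight_standard hk hm
  have hw := (standard m n).weight_apply_lab lam k
  rw [weight_standard, hlab] at hw
  have hs : ((standard m n).sign k : ℤ) = 1 := rfl
  rw [hs, mul_one] at hw
  rw [weight_flip, weight_standard, ← hw]
  have he : (standard m n).entry k = Pi.single (Sum.inr ⟨m - 1, by omega⟩) 1 := by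
    rw [entry, hlab]; rfl
  rw [he]
  funext a
  rcases a with i | j
  · simp [hashMinus]
  · rw [hashMinus]
    by_cases hj : (j : ℕ) + 1 = m
    · have hj' : j = ⟨m - 1, by omega⟩ := Fin.ext (by change (j : ℕ) = m - 1; omega)
      rw [if_pos hj, hj']
      simp
      ring
    · have hj' : j ≠ ⟨m - 1, by omega⟩ := fun h => hj (by rw [h]; change m - 1 + 1 = m; omega)
      rw [if_neg hj]
      simp [hj']

section

variable {V : Type*} [AddCommGroup V] [Module ℂ V] {M : OspModule m n V} {lam : YoungDiagram}

theorem hw_of_isL'_hash (D : SignedSeq m n) (hD : D.epsSign = 1) (hM : M.IsL' (hash m n lam)) :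
    M.HasHighestWeight D.pos (D.weight lam) := by
  refine hw_weight_of_epsSign_eq hM.1 (D := standard m n) (by rw [hD, epsSign_standard]) ?_
  rw [weight_standard, ← standardPos_eq]
  exact hM.2

/-- A product -1 forces m > 0. The standard Borel subalgebra is then also described by the sequence
with ε_m negated, which serves as base point for this class of signs. -/
theorem hw_of_isL'_hashMinus (D : SignedSeq m n) (hD : D.epsSign = -1)
    (hM : M.IsL' (hashMinus m n lam)) : M.HasHighestWeight D.pos (D.weight lam) := by
  have hm : 0 < m := by
    rw [Nat.pos_iff_ne_zero]
    rintro rfl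
    rw [D.eq_ofSign, epsSign_ofSign, Fin.prod_univ_zero] at hD
    exact absurd hD (by decide)
  have hN : n + m - 1 < n + m := by omega
  set k : Fin (n + m) := ⟨n + m - 1, hN⟩
  have hk : (k : ℕ) + 1 = n + m := by change n + m - 1 + 1 = n + m; omega
  have hr : ((standard m n).lab k).isRight = true := by rw [isRight_standard hk hm]; rfl
  refine hw_weight_of_epsSign_eq hM.1 (D := (standard m n).flip k)
    (by rw [hD, epsSign_flip _ hr, epsSign_standard]) ?_
  rw [weight_standard_flip lam hk hm, pos_flip_last _ hk hr, ← standardPos_eq]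
  exact hM.2

end

/-! ### Shape of the diagram and the last entry -/

theorem isBarShape_pos (D : SignedSeq m n) {k : Fin (n + m)} (hk : (k : ℕ) + 1 = n + m)
    (hl : (D.lab k).isLeft = true) : IsBarShape D.pos := by
  obtain ⟨i, hi⟩ := Sum.isLeft_iff.1 hl
  refine ⟨i, D.sign k, ?_⟩
  rw [simpleRoots_pos]
  refine Or.inl (Or.inr ⟨k, hk, hl, ?_⟩)
  rw [entry, hi, ← Pi.single_smul]
  simp

theorem isRight_last_of_isYShape {D : SignedSeq m n} (hY : IsYShape D.pos) {k : Fin (n + m)}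
    (hk : (k : ℕ) + 1 = n + m) : (D.lab k).isRight = true :=
  isRight_of_not_isLeft fun h => hY (D.isBarShape_pos hk h)

theorem epsBefore_add_one_eq_iff (D : SignedSeq m n) {k : Fin (n + m)} (hk : (k : ℕ) + 1 = n + m)
    (hr : (D.lab k).isRight = true) {i : Fin (n + m)} (hi : (D.lab i).isRight = true) :
    D.epsBefore i + 1 = m ↔ i = k := by
  have htot : (Finset.univ.filter fun l : Fin (n + m) => (D.lab l).isRight = true).card = m := by
    rw [Finset.card_filter, Equiv.sum_comp D.lab fun a => if a.isRight = true then 1 else 0,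
      Fintype.sum_sum_type]
    simp
  have hle : ∀ l : Fin (n + m), l ≤ k := fun l => Fin.le_def.2 (by have := l.2; omega)
  constructor
  · intro h
    by_contra hne
    have hlt : i < k := lt_of_le_of_ne (hle i) hne
    -- The ε's before place `i`, together with those in places `i` and `k`, would be too many if `i`
    -- were the `m`-th one.
    have : (insert k (insert i (Finset.univ.filter fun l : Fin (n + m) =>
        l < i ∧ (D.lab l).isRight = true))).card ≤ m := by
      refine (Finset.card_le_card ?_).trans htot.le
      intro l hl
      simp only [Finset.mem_insert, Finset.mem_filter, Finset.mem_univ, true_and] at hl ⊢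
      rcases hl with rfl | rfl | hl
      · exact hr
      · exact hi
      · exact hl.2
    rw [Finset.card_insert_of_notMem (by simp [hlt.ne', hlt.le]),
      Finset.card_insert_of_notMem (by simp)] at this
    change D.epsBefore i + 1 + 1 ≤ m at this
    omega
  · rintro rfl
    refine Eq.trans ?_ htot
    rw [epsBefore, ← Finset.card_insert_of_notMem (a := i) (by simp)]
    congr 1
    ext l
    simp only [Finset.mem_insert, Finset.mem_filter, Finset.mem_univ, true_and]
    constructor
    · rintro (rfl | h)
      · exact hi
      · exact h.2
    · intro h
      rcases (hle l).eq_or_lt with h1 | h1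
      · exact Or.inl h1
      · exact Or.inr ⟨h1, h⟩

/-- When the last place holds an ε, it is the one with index `m`. Thus λ^B_- is the weight of
another sequence with the same positive system and opposite ε-sign. -/
theorem weightMinus_eq (D : SignedSeq m n) (lam : YoungDiagram) {k : Fin (n + m)}
    (hk : (k : ℕ) + 1 = n + m) (hr : (D.lab k).isRight = true) :
    D.weightMinus lam = (D.flip k).weight lam := by
  refine Finset.sum_congr rfl fun i _ => ?_
  rw [frob_flip]
  by_cases hi : i = k
  · subst hi
    rw [if_pos ⟨hr, (D.epsBefore_add_one_eq_iff hk hr hr).2 rfl⟩, entry_flip_self]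
    simp
  · rw [if_neg fun h => hi ((D.epsBefore_add_one_eq_iff hk hr h.1).1 h.2), entry_flip_of_ne _ hi,
      one_smul]

/-- For Y-shape the parity normalisation is reached by negating the ε in the last place, which does
not alter the positive system. -/
theorem exists_describes {P : Set (Wt m n)} (hP : IsPositiveSystem P) :
    ∃ D : SignedSeq m n, D.Describes P := by
  obtain ⟨D, rfl⟩ := exists_eq_pos hP
  rcases Int.units_eq_one_or D.epsSign with h | h
  · exact ⟨D, D.simpleRoots_pos, fun _ => h⟩
  by_cases hY : IsYShape D.pos
  · have hN : 0 < n + m := by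
      by_contra h0
      have : IsEmpty (Fin (n + m)) := by
        have h0' : n + m = 0 := by omega
        rw [h0']; infer_instance
      rw [epsSign, Fintype.prod_empty] at h
      exact absurd h (by decide)
    have hk : ((⟨n + m - 1, by omega⟩ : Fin (n + m)) : ℕ) + 1 = n + m := by
      change n + m - 1 + 1 = n + m
      omega
    have hr := isRight_last_of_isYShape hY hk
    refine ⟨D.flip ⟨n + m - 1, by omega⟩, ?_, fun _ => ?_⟩
    · rw [← simpleRoots_pos, pos_flip_last D hk hr]
    · rw [epsSign_flip D hr, h, neg_neg]
  · exact ⟨D, D.simpleRoots_pos, fun h => absurd h hY⟩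

end SignedSeq

end Osp

/-! ### The theorem -/

theorem mainTheorem8 (m n : ℕ) (lam : YoungDiagram) (hlam : Osp.IsHook m n lam)
    (P : Set (Osp.Wt m n)) (hP : Osp.IsPositiveSystem P) :
    (∃ D : Osp.SignedSeq m n, D.Describes P) ∧
    ∀ D : Osp.SignedSeq m n, D.Describes P →
      ∀ (V : Type*) [AddCommGroup V] [Module ℂ V] (M : Osp.OspModule m n V),
        (Osp.IsYShape P →
          (M.IsL' (Osp.hash m n lam) → M.HasHighestWeight P (D.weight lam)) ∧
          (M.IsL' (Osp.hashMinus m n lam) → M.HasHighestWeight P (D.weightMinus lam))) ∧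
        (Osp.IsBarShape P →
          (D.epsSign = 1 →
            M.IsL' (Osp.hash m n lam) → M.HasHighestWeight P (D.weight lam)) ∧
          (D.epsSign = -1 →
            M.IsL' (Osp.hashMinus m n lam) → M.HasHighestWeight P (D.weight lam))) := by
  refine ⟨Osp.SignedSeq.exists_describes hP, fun D hD V _ _ M => ?_⟩
  obtain ⟨hsimple, hsign⟩ := hD
  obtain rfl := Osp.SignedSeq.eq_pos_of_simpleRoots hP hsimple
  refine ⟨fun hY => ⟨fun hM => D.hw_of_isL'_hash (hsign hY) hM, fun hM => ?_⟩,
    fun _ => ⟨fun h hM => D.hw_of_isL'_hash h hM, fun h hM => D.hw_of_isL'_hashMinus h hM⟩⟩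
  by_cases hN : 0 < n + m
  · have hk : ((⟨n + m - 1, by omega⟩ : Fin (n + m)) : ℕ) + 1 = n + m := by
      change n + m - 1 + 1 = n + m
      omega
    have hr := Osp.SignedSeq.isRight_last_of_isYShape hY hk
    rw [D.weightMinus_eq lam hk hr, ← D.pos_flip_last hk hr]
    refine Osp.SignedSeq.hw_of_isL'_hashMinus _ ?_ hM
    rw [Osp.SignedSeq.epsSign_flip D hr, hsign hY]
  -- Without any entries there is no last place to negate, but then zero is the only weight.
  · obtain ⟨rfl, rfl⟩ : n = 0 ∧ m = 0 := by omega
    have h1 : D.weightMinus lam = D.weight lam := Subsingleton.elim _ _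
    have h2 : Osp.hashMinus 0 0 lam = Osp.hash 0 0 lam := Subsingleton.elim _ _
    rw [h1]
    rw [h2] at hM
    exact D.hw_of_isL'_hash (hsign hY) hM
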